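/- Random graph (model M1). Let $\alpha\in(1,2)$ and, for each $n$, let $k=k_n$ be $\lceil n^{2-\alpha}\rceil$ or $\lfloor n^{2-\alpha}\rfloor$. Take the cycle with node set $\{0,1,\dots,n-1\}$ (clockwise meaning $x\mapsto x+1 \bmod n$), and on it the $2k$ almost equidistant nodes $v_i=\lfloor i\,n^{\alpha-1}/2\rfloor \bmod n$, $0\le i<2k$. Assume that the choice of $k_n$ is such that these nodes are pairwise distinct for all large $n$ (this always holds for $k_n=\lfloor n^{2-\alpha}\rfloor$). Add the $k$ edges (long range edges) of a uniformly random perfect matching of $\{v_0,\dots,v_{2k-1}\}$. Homogeneous chain. For parameters $q_c>0$, $q_l>0$, $|r|\le q_c$ and $d\ge 1$, the homogeneous chain moves clockwise along the cycle with probability $q_c+r$, counterclockwise with probability $q_c-r$, along a long range edge at the current node (there is at most one) with probability $q_l/d$, and otherwise stays put; if a long range edge coincides with a cycle edge the probabilities are added. It is lazy (holding probability at least $1/2$ at every node) when $2q_c+q_l/d\le \tfrac12$. Mixing time. For $\varepsilon>0$ and a transition matrix $P$ with unique stationary distribution $\pi$, let $$t_{\rm mix}(P,\varepsilon)=\max_{\sigma}\min\{t\ge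 0:\|\sigma P^t-\pi\|_{\rm TV}\le\varepsilon\},$$ the maximum being over all probability distributions $\sigma$ on the nodes, where $\|\mu-\nu\|_{\rm TV}=\max_A|\mu(A)-\nu(A)|$. Theorem. Let $\varepsilon\in(0,1)$, $q_c>0$, $q_l>0$ and $|r|\le q_c$. There are constants $c_1,c_2>0$, depending only on $\varepsilon,q_c,q_l,r$, such that for every $\alpha\in(1,2)$, every $d=d(\alpha)\ge1$ with $2q_c+q_l/d\le\frac12$, and every choice of $k_n$ as above, with probability tending to $1$ as $n\to\infty$ the homogeneous lazy chain $P$ on the random graph of model M1 has a unique stationary distribution and $$c_1\,n^{\alpha-1}<t_{\rm mix}(P,\varepsilon)<c_2\,d(\alpha)^2\,n^{2\alpha-2}\log n .$$ -/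

import Mathlib

/-- Total variation distance of two (probability) vectors on a finite set:
the maximum over all events `A` of `|μ(A) - ν(A)|`. -/
noncomputable def tvDist {X : Type} [Fintype X] (μ ν : X → ℝ) : ℝ :=
  ⨆ A : Finset X, |∑ x ∈ A, μ x - ∑ x ∈ A, ν x|

/-- `π` is the unique stationary distribution of the transition matrix `P`. -/
def IsUniqueStationary {X : Type} [Fintype X] (P : Matrix X X ℝ) (π : X → ℝ) : Prop :=
  π ∈ stdSimplex ℝ X ∧ Matrix.vecMul π P = π ∧
    ∀ ρ ∈ stdSimplex ℝ X, Matrix.vecMul ρ P = ρ → ρ = π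

/-- The maximum over all starting distributions `σ` of the least `t` with
`‖σ P ^ t - π‖_TV ≤ ε`. It is `⊤` if for some `σ` there is no such `t`, or if these times
are unbounded. -/
noncomputable def mixingTimeTo {X : Type} [Fintype X] [DecidableEq X]
    (P : Matrix X X ℝ) (π : X → ℝ) (ε : ℝ) : ℕ∞ :=
  ⨆ σ ∈ stdSimplex ℝ X,
    ⨅ t : ℕ, ⨅ _ : tvDist (Matrix.vecMul σ (P ^ t)) π ≤ ε, (t : ℕ∞)

/-- `P` has a unique stationary distribution and its mixing time `t_mix(P, ε)` is the
(finite) number `T`. -/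
def HasMixingTime {X : Type} [Fintype X] [DecidableEq X]
    (P : Matrix X X ℝ) (ε : ℝ) (T : ℕ) : Prop :=
  ∃ π : X → ℝ, IsUniqueStationary P π ∧ mixingTimeTo P π ε = (T : ℕ∞)

/-- The perfect matchings of `{0, …, m - 1}`, each given as the fixed-point-free involution
that sends every element to its partner. -/
def perfectMatchings (m : ℕ) : Finset (Equiv.Perm (Fin m)) :=
  Finset.univ.filter fun s => ∀ i, s i ≠ i ∧ s (s i) = i

open Classical in
/-- The probability of the event `E` for a uniformly random perfect matching of
`{0, …, m - 1}`. -/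
noncomputable def matchingProb (m : ℕ) (E : Equiv.Perm (Fin m) → Prop) : ℝ :=
  (((perfectMatchings m).filter E).card : ℝ) / ((perfectMatchings m).card : ℝ)

/-- The position on the `n`-cycle `{0, …, n - 1}` of the `i`-th almost equidistant node:
`⌊i n^(α-1) / 2⌋`, read modulo `n`. -/
noncomputable def m1Node (α : ℝ) (n i : ℕ) : ℕ :=
  ⌊(i : ℝ) * (n : ℝ) ^ (α - 1) / 2⌋₊ % n

/-- Adjacency along a long range edge: the `i`-th and the `s i`-th almost equidistant nodes are
joined, for the matching `s`. -/
def m1LongRange (α : ℝ) (n k : ℕ) (s : Equiv.Perm (Fin (2 * k))) (x y : Fin n) : Prop :=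
  ∃ i : Fin (2 * k), m1Node α n i = x ∧ m1Node α n (s i) = y

open Classical in
/-- The probability of a move of the homogeneous chain from `x` to `y`: clockwise (to `x + 1`)
`qc + r`, counterclockwise `qc - r`, along a long range edge `ql / d`. -/
noncomputable def m1Step (α : ℝ) (n k : ℕ) (s : Equiv.Perm (Fin (2 * k)))
    (qc ql r d : ℝ) (x y : Fin n) : ℝ :=
  (if ((x : ℕ) + 1) % n = y then qc + r else 0) +
  (if ((y : ℕ) + 1) % n = x then qc - r else 0) +
  (if m1LongRange α n k s x y then ql / d else 0)

/-- The transition matrix of the homogeneous chain on the `n`-cycle with the long range edges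
given by the matching `s` of `2 * k` almost equidistant nodes; with the remaining probability the
chain stays put. -/
noncomputable def m1Chain (α : ℝ) (n k : ℕ) (s : Equiv.Perm (Fin (2 * k)))
    (qc ql r d : ℝ) : Matrix (Fin n) (Fin n) ℝ :=
  fun x y => m1Step α n k s qc ql r d x y +
    if x = y then 1 - ∑ z, m1Step α n k s qc ql r d x z else 0

/-! Write `L = n^(α-1)` for twice the mean spacing of the nodes, so that `k` is `n / L` up to an
error of 1. The chain is doubly stochastic: the drift circulates around the cycle and the matching
is symmetric. Hence the uniform distribution is stationary.

Upper bound. With high probability every set `S` of at most half the vertices has outflow at least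
`Φ * #S`, where `Φ` is of order `1 / (d * L)`. Cheeger's inequality and laziness, without
reversibility, then shrink the squared ℓ² distance to uniform by `exp (-Φ² / 8)` per step
(`sum_vecMul_sq_le_exp`). This gives uniqueness of the stationary distribution and mixing after `24
log n / Φ²` steps.

The outflow bound reduces to expansion of a random matching added to the path `0, …, 2k - 1`
(`card_not_isExpanding_le`). It is enough to treat sets closed under the matching, as points with
partner outside are themselves counted as cut edges. At most `2 * (2k choose b)` sets have `b`
boundary edges, and a set of `2p` points is closed with probability at most `1 / (k choose p)`. For
`p ≥ 20 b` the union bound sums to at most `800 / k`. To pass to the cycle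
(`card_le_of_isExpanding`), cut it into arcs of length `O(L)` at the nodes: an arc that meets `S`
either starts in `S` or contains a boundary edge of `S`.

Lower bound. A walk started midway between the second and third nodes meets no long range edge for
`L / 16` steps. Until then it is confined to an interval of about `L / 8` vertices, a vanishing
fraction of the cycle. -/

namespace SmallWorld
open Finset

/-! ### Cheeger's inequality and mixing for lazy doubly stochastic matrices -/

section Cheeger

variable {X : Type} [Fintype X] [DecidableEq X]

/-- A discrete co-area formula: `h` is peeled level by level. Subtracting its least nonzero value
`δ` on its support `S` lowers the right side by `δ` times the cut of `S` and the left side by `Φ * δ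
* #S`, and the support gets smaller. -/
theorem mul_sum_le_sum_posPart_of_cut (w : X → X → ℝ) (Φ : ℝ)
    (hcut : ∀ S : Finset X, 2 * #S ≤ Fintype.card X → Φ * #S ≤ ∑ x ∈ S, ∑ y ∈ Sᶜ, w x y)
    (h : X → ℝ) (h0 : ∀ x, 0 ≤ h x) (hs : 2 * #{x | h x ≠ 0} ≤ Fintype.card X) :
    Φ * ∑ x, h x ≤ ∑ x, ∑ y, w x y * max (h x - h y) 0 := by
  induction hN : #{x | h x ≠ 0} using Nat.strong_induction_on generalizing h with
  | _ N ih =>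
  set S : Finset X := {x | h x ≠ 0} with hS
  have memS : ∀ x, x ∈ S ↔ h x ≠ 0 := fun x => by simp [hS]
  rcases S.eq_empty_or_nonempty with hE | hne
  · have hz : ∀ x, h x = 0 := fun x => by
      by_contra hx
      have := (memS x).2 hx
      simp [hE] at this
    simp [hz]
  · obtain ⟨x₀, hx₀, hmin⟩ := S.exists_min_image h hne
    set δ := h x₀ with hδ
    have hδ0 : 0 ≤ δ := h0 _
    set h' : X → ℝ := fun x => if x ∈ S then h x - δ else 0 with hh'
    have key := ih #{x | h' x ≠ 0} ?_ h' ?_ ?_ rfl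
    · have hcutS := hcut S hs
      have e1 : ∑ x, h x = ∑ x, h' x + δ * #S := by
        have : ∀ x, h x = h' x + if x ∈ S then δ else 0 := fun x => by
          by_cases hx : x ∈ S
          · simp [hh', hx]
          · have : h x = 0 := by simpa [memS] using hx
            simp [hh', hx, this]
        rw [sum_congr rfl fun x _ => this x, sum_add_distrib, ← sum_filter]
        simp [mul_comm]
      have e2 : ∑ x, ∑ y, w x y * max (h x - h y) 0
          = ∑ x, ∑ y, w x y * max (h' x - h' y) 0 + δ * ∑ x ∈ S, ∑ y ∈ Sᶜ, w x y := by
        have hp : ∀ x y, w x y * max (h x - h y) 0 = w x y * max (h' x - h' y) 0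
            + δ * (if x ∈ S then (if y ∈ Sᶜ then w x y else 0) else 0) := fun x y => by
          by_cases hx : x ∈ S <;> by_cases hy : y ∈ S
          · simp [hh', hx, hy]
          · have hy' : h y = 0 := by simpa [memS] using hy
            have := hmin x hx
            simp [hh', hx, hy, hy', h0 x, this]
            ring
          · have hx' : h x = 0 := by simpa [memS] using hx
            have := hmin y hy
            simp [hh', hx, hy, hx', h0 y, this]
          · have hx' : h x = 0 := by simpa [memS] using hx
            have hy' : h y = 0 := by simpa [memS] using hy
            simp [hh', hx, hy, hx', hy']
        simp_rw [hp, sum_add_distrib, ← mul_sum]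
        congr 2
        have hS' : ∀ x, (∑ y, if x ∈ S then (if y ∈ Sᶜ then w x y else 0) else 0)
            = if x ∈ S then ∑ y ∈ Sᶜ, w x y else 0 := fun x => by
          by_cases hx : x ∈ S
          · simp only [hx, if_true, sum_ite_mem, univ_inter]
          · simp [hx]
        simp_rw [hS', sum_ite_mem, univ_inter]
      rw [e1, e2, mul_add]
      nlinarith [mul_le_mul_of_nonneg_left hcutS hδ0]
    · rw [← hN]
      apply card_lt_card
      refine ⟨fun x hx => ?_, fun hsub => ?_⟩
      · by_contra hxS
        simp [hh', hxS] at hx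
      · have := hsub hx₀
        simp [hh', hδ] at this
    · intro x
      by_cases hx : x ∈ S
      · simpa [hh', hx] using hmin x hx
      · simp [hh', hx]
    · refine le_trans (Nat.mul_le_mul_left _ (card_le_card fun x hx => ?_)) hs
      by_contra hxS
      simp [hh', hxS] at hx


/-- The co-area bound is applied to `g²`; then `g x ² - g y ² = (g x - g y) (g x + g y)` is split by
Cauchy–Schwarz. Double stochasticity bounds the factor with `g x + g y` by four times the sum of
squares. -/
theorem sq_mul_sum_sq_le_of_cut (P : X → X → ℝ) (Φ : ℝ) (hΦ : 0 ≤ Φ)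
    (hP : ∀ x y, 0 ≤ P x y) (hrow : ∀ x, ∑ y, P x y = 1) (hcol : ∀ y, ∑ x, P x y = 1)
    (hcut : ∀ S : Finset X, 2 * #S ≤ Fintype.card X → Φ * #S ≤ ∑ x ∈ S, ∑ y ∈ Sᶜ, P x y)
    (g : X → ℝ) (g0 : ∀ x, 0 ≤ g x) (hs : 2 * #{x | g x ≠ 0} ≤ Fintype.card X) :
    Φ ^ 2 * ∑ x, g x ^ 2 ≤ 4 * ∑ x, ∑ y, P x y * (g x - g y) ^ 2 := by
  set G := ∑ x, g x ^ 2 with hG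
  set D := ∑ x, ∑ y, P x y * (g x - g y) ^ 2 with hD
  have hG0 : 0 ≤ G := sum_nonneg fun x _ => sq_nonneg _
  have hD0 : 0 ≤ D := sum_nonneg fun x _ => sum_nonneg fun y _ => mul_nonneg (hP x y) (sq_nonneg _)
  have h1 : Φ * G ≤ ∑ x, ∑ y, P x y * (|g x - g y| * (g x + g y)) := by
    refine (mul_sum_le_sum_posPart_of_cut P Φ hcut (fun x => g x ^ 2) (fun x => sq_nonneg _)
      (by simpa using hs)).trans ?_
    refine sum_le_sum fun x _ => sum_le_sum fun y _ => mul_le_mul_of_nonneg_left ?_ (hP x y)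
    have := add_nonneg (g0 x) (g0 y)
    refine max_le ?_ (by positivity)
    have e : g x ^ 2 - g y ^ 2 = (g x - g y) * (g x + g y) := by ring
    rw [e]
    exact mul_le_mul_of_nonneg_right (le_abs_self _) this
  have h2 : ∑ x, ∑ y, P x y * (g x + g y) ^ 2 ≤ 4 * G := by
    have : ∑ x, ∑ y, P x y * (2 * g x ^ 2 + 2 * g y ^ 2) = 4 * G := by
      simp_rw [mul_add, sum_add_distrib, ← sum_mul, hrow]
      rw [sum_comm]
      simp_rw [← sum_mul, hcol, one_mul, ← mul_sum]
      ring
    rw [← this]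
    refine sum_le_sum fun x _ => sum_le_sum fun y _ => mul_le_mul_of_nonneg_left ?_ (hP x y)
    nlinarith [sq_nonneg (g x - g y)]
  have h3 : (∑ x, ∑ y, P x y * (|g x - g y| * (g x + g y))) ^ 2
      ≤ D * ∑ x, ∑ y, P x y * (g x + g y) ^ 2 := by
    simp only [hD, ← Fintype.sum_prod_type']
    refine sum_sq_le_sum_mul_sum_of_sq_le_mul _ (fun p _ => mul_nonneg (hP _ _) (sq_nonneg _))
      (fun p _ => mul_nonneg (hP _ _) (sq_nonneg _)) fun p _ => ?_
    rw [mul_pow, mul_pow, sq_abs]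
    exact le_of_eq (by ring)
  have h4 : (Φ * G) ^ 2 ≤ D * (4 * G) :=
    (pow_le_pow_left₀ (by positivity) h1 2).trans (h3.trans (mul_le_mul_of_nonneg_left h2 hD0))
  rcases hG0.eq_or_lt with h | h
  · rw [← h]; simpa using hD0
  · have : (Φ ^ 2 * G) * G ≤ (4 * D) * G := by nlinarith
    exact le_of_mul_le_mul_right this h

theorem exists_median {X : Type} [Fintype X] (f : X → ℝ) [Nonempty X] :
    ∃ m : ℝ, 2 * #{x | m < f x} ≤ Fintype.card X ∧ 2 * #{x | f x < m} ≤ Fintype.card X := by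
  set V : Finset ℝ := univ.image f
  have hV : ∀ x, f x ∈ V := fun x => mem_image_of_mem f (mem_univ x)
  have hVne : V.Nonempty := univ_nonempty.image f
  set W : Finset ℝ := {v ∈ V | 2 * #{x | v < f x} ≤ Fintype.card X} with hW
  have hWne : W.Nonempty := by
    refine ⟨V.max' hVne, mem_filter.2 ⟨V.max'_mem hVne, ?_⟩⟩
    have : (univ.filter fun x => V.max' hVne < f x) = ∅ :=
      filter_eq_empty_iff.2 fun x _ => not_lt.2 (V.le_max' _ (hV x))
    rw [this, card_empty]
    exact Nat.zero_le _
  -- The median is the least value with at most half of the points strictly above it. By minimality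
  -- the preceding value, if any, has more than half of the points above it.
  refine ⟨W.min' hWne, (mem_filter.1 (W.min'_mem hWne)).2, ?_⟩
  set m := W.min' hWne
  rcases (V.filter (· < m)).eq_empty_or_nonempty with h | h
  · have : (univ.filter fun x => f x < m) = ∅ :=
      filter_eq_empty_iff.2 fun x _ hx => by
        have : f x ∈ V.filter (· < m) := mem_filter.2 ⟨hV x, hx⟩
        simp [h] at this
    simp [this]
  · obtain ⟨v, hv, hmax⟩ := (V.filter (· < m)).exists_max_image id h
    obtain ⟨hvV, hvm⟩ := mem_filter.1 hv
    have hvW : ¬ 2 * #{x | v < f x} ≤ Fintype.card X := fun hc =>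
      absurd (W.min'_le v (mem_filter.2 ⟨hvV, hc⟩)) (not_le.2 hvm)
    have hsub : #{x | f x < m} ≤ #{x | ¬ v < f x} :=
      card_le_card fun x hx => by
        have hx' : f x < m := by simpa using hx
        have := hmax (f x) (mem_filter.2 ⟨hV x, hx'⟩)
        simpa using this
    have := card_filter_add_card_filter_not (s := (univ : Finset X)) (fun x => v < f x)
    rw [card_univ] at this
    omega

/-- Cheeger's inequality for a doubly stochastic matrix. -/
theorem cheeger (P : X → X → ℝ) (Φ : ℝ) (hΦ : 0 ≤ Φ)
    (hP : ∀ x y, 0 ≤ P x y) (hrow : ∀ x, ∑ y, P x y = 1) (hcol : ∀ y, ∑ x, P x y = 1)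
    (hcut : ∀ S : Finset X, 2 * #S ≤ Fintype.card X → Φ * #S ≤ ∑ x ∈ S, ∑ y ∈ Sᶜ, P x y)
    (g : X → ℝ) (hg : ∑ x, g x = 0) :
    Φ ^ 2 * ∑ x, g x ^ 2 ≤ 4 * ∑ x, ∑ y, P x y * (g x - g y) ^ 2 := by
  rcases isEmpty_or_nonempty X with hX | hX
  · simp
  -- The parts of `g` above and below a median each have support of at most half the points.
  -- Centring at `m` instead of the mean 0 can only increase the sum of squares, and truncation does
  -- not increase the total Dirichlet form.
  obtain ⟨m, hm1, hm2⟩ := exists_median g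
  have a1 := sq_mul_sum_sq_le_of_cut P Φ hΦ hP hrow hcol hcut (fun x => max (g x - m) 0)
    (fun x => le_max_right _ _)
    (le_trans (Nat.mul_le_mul_left _ (card_le_card fun x hx => by
      simpa [sub_pos] using hx)) hm1)
  have a2 := sq_mul_sum_sq_le_of_cut P Φ hΦ hP hrow hcol hcut (fun x => max (m - g x) 0)
    (fun x => le_max_right _ _)
    (le_trans (Nat.mul_le_mul_left _ (card_le_card fun x hx => by
      simpa [sub_pos] using hx)) hm2)
  have b1 : ∑ x, g x ^ 2 ≤ ∑ x, max (g x - m) 0 ^ 2 + ∑ x, max (m - g x) 0 ^ 2 := by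
    have : ∑ x, g x ^ 2 ≤ ∑ x, (g x - m) ^ 2 := by
      have : ∑ x, (g x - m) ^ 2 = ∑ x, g x ^ 2 - 2 * m * ∑ x, g x + ∑ _x : X, m ^ 2 := by
        rw [mul_sum, ← sum_sub_distrib, ← sum_add_distrib]
        exact sum_congr rfl fun x _ => by ring
      rw [this, hg]
      have : 0 ≤ ∑ _x : X, m ^ 2 := sum_nonneg fun _ _ => sq_nonneg m
      linarith
    refine this.trans ?_
    rw [← sum_add_distrib]
    refine sum_le_sum fun x _ => ?_
    rcases le_total (g x) m with h | h
    · rw [max_eq_right (sub_nonpos.2 h), max_eq_left (sub_nonneg.2 h)]; nlinarith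
    · rw [max_eq_left (sub_nonneg.2 h), max_eq_right (sub_nonpos.2 h)]; nlinarith
  have b2 : ∑ x, ∑ y, P x y * (max (g x - m) 0 - max (g y - m) 0) ^ 2
      + ∑ x, ∑ y, P x y * (max (m - g x) 0 - max (m - g y) 0) ^ 2
      ≤ ∑ x, ∑ y, P x y * (g x - g y) ^ 2 := by
    simp_rw [← sum_add_distrib, ← mul_add]
    refine sum_le_sum fun x _ => sum_le_sum fun y _ => mul_le_mul_of_nonneg_left ?_ (hP x y)
    rcases le_total (g x) m with h | h <;> rcases le_total (g y) m with h' | h'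
    · rw [max_eq_right (sub_nonpos.2 h), max_eq_left (sub_nonneg.2 h),
        max_eq_right (sub_nonpos.2 h'), max_eq_left (sub_nonneg.2 h')]; nlinarith
    · rw [max_eq_right (sub_nonpos.2 h), max_eq_left (sub_nonneg.2 h),
        max_eq_left (sub_nonneg.2 h'), max_eq_right (sub_nonpos.2 h')]
      nlinarith [mul_nonneg (sub_nonneg.2 h) (sub_nonneg.2 h')]
    · rw [max_eq_left (sub_nonneg.2 h), max_eq_right (sub_nonpos.2 h),
        max_eq_right (sub_nonpos.2 h'), max_eq_left (sub_nonneg.2 h')]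
      nlinarith [mul_nonneg (sub_nonneg.2 h) (sub_nonneg.2 h')]
    · rw [max_eq_left (sub_nonneg.2 h), max_eq_right (sub_nonpos.2 h),
        max_eq_left (sub_nonneg.2 h'), max_eq_right (sub_nonpos.2 h')]; nlinarith
  have := mul_le_mul_of_nonneg_left b1 (sq_nonneg Φ)
  linarith

/-- For fixed `y`, with `M = (gP)(y)` and `A = ∑ x, P x y (g x - g y)²`, one has `M² = ∑ x, P x y (g
x)² - A + (M - g y)²`. Laziness leaves column mass at most `1/2` off the diagonal, so Cauchy–Schwarz
gives `(M - g y)² ≤ A / 2`. Reversibility plays no role. -/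
theorem sum_vecMul_sq_le (P : Matrix X X ℝ) (hP : ∀ x y, 0 ≤ P x y)
    (hrow : ∀ x, ∑ y, P x y = 1) (hcol : ∀ y, ∑ x, P x y = 1) (hlazy : ∀ x, 1 / 2 ≤ P x x)
    (g : X → ℝ) :
    ∑ y, Matrix.vecMul g P y ^ 2
      ≤ ∑ x, g x ^ 2 - 1 / 2 * ∑ x, ∑ y, P x y * (g x - g y) ^ 2 := by
  have key : ∀ y, Matrix.vecMul g P y ^ 2
      ≤ ∑ x, P x y * g x ^ 2 - 1 / 2 * ∑ x, P x y * (g x - g y) ^ 2 := fun y => by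
    set M := Matrix.vecMul g P y with hM
    set A := ∑ x, P x y * (g x - g y) ^ 2 with hA
    have hMsum : ∑ x, P x y * g x = M := by
      simp [hM, Matrix.vecMul, dotProduct, mul_comm]
    have eA : A = ∑ x, P x y * g x ^ 2 - 2 * g y * M + g y ^ 2 := by
      have : ∑ x, P x y * g y ^ 2 = g y ^ 2 := by rw [← sum_mul, hcol, one_mul]
      rw [← hMsum, mul_sum, ← this, ← sum_sub_distrib, ← sum_add_distrib]
      exact sum_congr rfl fun x _ => by ring
    have eM : M - g y = ∑ x ∈ univ.erase y, P x y * (g x - g y) := by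
      have h := add_sum_erase univ (fun x => P x y * (g x - g y)) (mem_univ y)
      have h' : ∑ x, P x y * (g x - g y) = M - g y := by
        simp_rw [mul_sub, sum_sub_distrib, ← sum_mul, hcol, hMsum, one_mul]
      simp only [sub_self, mul_zero, zero_add] at h
      rw [h, h']
    have hR : ∑ x ∈ univ.erase y, P x y ≤ 1 / 2 := by
      have h := add_sum_erase univ (fun x => P x y) (mem_univ y)
      have := hlazy y
      simp only [hcol] at h
      linarith
    have hAe : ∑ x ∈ univ.erase y, P x y * (g x - g y) ^ 2 = A := by
      have h := add_sum_erase univ (fun x => P x y * (g x - g y) ^ 2) (mem_univ y)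
      simpa only [sub_self, ne_eq, OfNat.ofNat_ne_zero, not_false_eq_true, zero_pow, mul_zero,
        zero_add] using h
    have hA0 : 0 ≤ A := sum_nonneg fun x _ => mul_nonneg (hP x y) (sq_nonneg _)
    have hCS : (M - g y) ^ 2 ≤ 1 / 2 * A := by
      rw [eM]
      refine (sum_sq_le_sum_mul_sum_of_sq_le_mul (univ.erase y) (f := fun x => P x y)
        (g := fun x => P x y * (g x - g y) ^ 2) (fun x _ => hP x y)
        (fun x _ => mul_nonneg (hP x y) (sq_nonneg _)) fun x _ => le_of_eq (by ring)).trans ?_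
      rw [hAe]
      exact mul_le_mul_of_nonneg_right hR hA0
    nlinarith
  refine (sum_le_sum fun y _ => key y).trans (le_of_eq ?_)
  rw [sum_sub_distrib, ← mul_sum, sum_comm, sum_comm (f := fun x y => P y x * (g y - g x) ^ 2)]
  simp_rw [← sum_mul, hrow, one_mul]

theorem sum_vecMul_eq {X : Type} [Fintype X] (P : Matrix X X ℝ) (hrow : ∀ x, ∑ y, P x y = 1) (g : X → ℝ) :
    ∑ y, Matrix.vecMul g P y = ∑ x, g x := by
  simp only [Matrix.vecMul, dotProduct]
  rw [sum_comm]
  simp_rw [← mul_sum, hrow, mul_one]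


theorem sum_vecMul_sq_le_exp (P : Matrix X X ℝ) (Φ : ℝ) (hΦ : 0 ≤ Φ) (hP : ∀ x y, 0 ≤ P x y)
    (hrow : ∀ x, ∑ y, P x y = 1) (hcol : ∀ y, ∑ x, P x y = 1) (hlazy : ∀ x, 1 / 2 ≤ P x x)
    (hcut : ∀ S : Finset X, 2 * #S ≤ Fintype.card X → Φ * #S ≤ ∑ x ∈ S, ∑ y ∈ Sᶜ, P x y)
    (g : X → ℝ) (hg : ∑ x, g x = 0) :
    ∑ y, Matrix.vecMul g P y ^ 2 ≤ Real.exp (-(Φ ^ 2 / 8)) * ∑ x, g x ^ 2 := by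
  have h1 := sum_vecMul_sq_le P hP hrow hcol hlazy g
  have h2 := cheeger P Φ hΦ hP hrow hcol hcut g hg
  have h3 : 0 ≤ ∑ x, g x ^ 2 := sum_nonneg fun _ _ => sq_nonneg _
  have h4 := mul_le_mul_of_nonneg_right (Real.add_one_le_exp (-(Φ ^ 2 / 8))) h3
  linarith

theorem sum_vecMul_pow_sq_le_exp (P : Matrix X X ℝ) (Φ : ℝ) (hΦ : 0 ≤ Φ) (hP : ∀ x y, 0 ≤ P x y)
    (hrow : ∀ x, ∑ y, P x y = 1) (hcol : ∀ y, ∑ x, P x y = 1) (hlazy : ∀ x, 1 / 2 ≤ P x x)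
    (hcut : ∀ S : Finset X, 2 * #S ≤ Fintype.card X → Φ * #S ≤ ∑ x ∈ S, ∑ y ∈ Sᶜ, P x y)
    (g : X → ℝ) (hg : ∑ x, g x = 0) (t : ℕ) :
    ∑ x, Matrix.vecMul g (P ^ t) x = 0 ∧
    ∑ y, Matrix.vecMul g (P ^ t) y ^ 2 ≤ Real.exp (-(Φ ^ 2 / 8) * t) * ∑ x, g x ^ 2 := by
  induction t with
  | zero => simp [hg]
  | succ t ih =>
    rw [pow_succ, ← Matrix.vecMul_vecMul]
    refine ⟨(sum_vecMul_eq P hrow _).trans ih.1, ?_⟩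
    refine (sum_vecMul_sq_le_exp P Φ hΦ hP hrow hcol hlazy hcut _ ih.1).trans ?_
    refine (mul_le_mul_of_nonneg_left ih.2 (Real.exp_pos _).le).trans (le_of_eq ?_)
    rw [← mul_assoc, ← Real.exp_add]
    congr 2
    push_cast; ring

theorem le_tvDist {X : Type} [Fintype X] (μ ν : X → ℝ) (A : Finset X) :
    |∑ x ∈ A, μ x - ∑ x ∈ A, ν x| ≤ tvDist μ ν :=
  le_ciSup (f := fun A : Finset X => |∑ x ∈ A, μ x - ∑ x ∈ A, ν x|) (Set.finite_range _).bddAbove A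

theorem tvDist_le_sqrt {X : Type} [Fintype X] (μ ν : X → ℝ) :
    tvDist μ ν ≤ √(Fintype.card X * ∑ x, (μ x - ν x) ^ 2) := by
  refine ciSup_le fun A => Real.abs_le_sqrt ?_
  rw [← sum_sub_distrib]
  refine (sq_sum_le_card_mul_sum_sq (s := A)).trans ?_
  have h1 : (#A : ℝ) ≤ Fintype.card X := by exact_mod_cast card_le_univ A
  exact mul_le_mul h1 (sum_le_sum_of_subset_of_nonneg (subset_univ _) fun _ _ _ => sq_nonneg _)
    (sum_nonneg fun _ _ => sq_nonneg _) (Nat.cast_nonneg _)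

theorem sum_sub_uniform_sq_le {X : Type} [Fintype X] [Nonempty X] (σ : X → ℝ) (hσ : σ ∈ stdSimplex ℝ X) :
    ∑ x, (σ x - 1 / Fintype.card X) = 0 ∧ ∑ x, (σ x - 1 / Fintype.card X : ℝ) ^ 2 ≤ 1 := by
  have hn : (Fintype.card X : ℝ) ≠ 0 := Nat.cast_ne_zero.2 Fintype.card_ne_zero
  have h1 : ∑ _x : X, (1 / Fintype.card X : ℝ) = 1 := by simp [hn]
  refine ⟨by rw [sum_sub_distrib, hσ.2, h1, sub_self], ?_⟩
  have h2 : ∑ x, (σ x - 1 / Fintype.card X : ℝ) ^ 2 = ∑ x, σ x ^ 2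
      - 2 * (1 / Fintype.card X) * ∑ x, σ x
      + (1 / Fintype.card X) * ∑ _x : X, (1 / Fintype.card X : ℝ) := by
    rw [mul_sum, mul_sum, ← sum_sub_distrib, ← sum_add_distrib]
    exact sum_congr rfl fun x _ => by ring
  have h3 : ∑ x, σ x ^ 2 ≤ ∑ x, σ x := sum_le_sum fun x _ => by
    have : σ x ≤ 1 := hσ.2 ▸ single_le_sum (fun y _ => hσ.1 y) (mem_univ x)
    nlinarith [hσ.1 x]
  have h4 : (0 : ℝ) ≤ 1 / Fintype.card X := by positivity
  rw [h2, h1]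
  rw [hσ.2] at h3 ⊢
  linarith

theorem vecMul_uniform {X : Type} [Fintype X] (P : Matrix X X ℝ) (hcol : ∀ y, ∑ x, P x y = 1) (a : ℝ) :
    Matrix.vecMul (fun _ => a) P = fun _ => a := by
  ext y
  simp [Matrix.vecMul, dotProduct, ← mul_sum, hcol]

theorem isUniqueStationary_uniform [Nonempty X] (P : Matrix X X ℝ) (Φ : ℝ) (hΦ : 0 < Φ)
    (hP : ∀ x y, 0 ≤ P x y)
    (hrow : ∀ x, ∑ y, P x y = 1) (hcol : ∀ y, ∑ x, P x y = 1) (hlazy : ∀ x, 1 / 2 ≤ P x x)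
    (hcut : ∀ S : Finset X, 2 * #S ≤ Fintype.card X → Φ * #S ≤ ∑ x ∈ S, ∑ y ∈ Sᶜ, P x y) :
    IsUniqueStationary P fun _ => 1 / (Fintype.card X : ℝ) := by
  have hn : (Fintype.card X : ℝ) ≠ 0 := Nat.cast_ne_zero.2 Fintype.card_ne_zero
  refine ⟨⟨fun _ => by positivity, by simp [hn]⟩, vecMul_uniform P hcol _, fun ρ hρ hst => ?_⟩
  have h := sum_vecMul_sq_le_exp P Φ hΦ.le hP hrow hcol hlazy hcut
    (ρ - fun _ => 1 / (Fintype.card X : ℝ)) (sum_sub_uniform_sq_le ρ hρ).1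
  rw [Matrix.sub_vecMul, hst, vecMul_uniform P hcol] at h
  set G := ∑ x, (ρ - fun _ => 1 / (Fintype.card X : ℝ) : X → ℝ) x ^ 2 with hG
  have hG0 : 0 ≤ G := sum_nonneg fun _ _ => sq_nonneg _
  have he : Real.exp (-(Φ ^ 2 / 8)) < 1 := by rw [Real.exp_lt_one_iff]; have := pow_pos hΦ 2; linarith
  have hG1 : G = 0 := by nlinarith
  ext x
  have := (sum_eq_zero_iff_of_nonneg fun _ _ => sq_nonneg _).1 hG1 x (mem_univ x)
  simpa [sub_eq_zero] using this

theorem tvDist_vecMul_pow_le [Nonempty X] (P : Matrix X X ℝ) (Φ : ℝ) (hΦ : 0 ≤ Φ)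
    (hP : ∀ x y, 0 ≤ P x y)
    (hrow : ∀ x, ∑ y, P x y = 1) (hcol : ∀ y, ∑ x, P x y = 1) (hlazy : ∀ x, 1 / 2 ≤ P x x)
    (hcut : ∀ S : Finset X, 2 * #S ≤ Fintype.card X → Φ * #S ≤ ∑ x ∈ S, ∑ y ∈ Sᶜ, P x y)
    (σ : X → ℝ) (hσ : σ ∈ stdSimplex ℝ X) (t : ℕ) :
    tvDist (Matrix.vecMul σ (P ^ t)) (fun _ => 1 / (Fintype.card X : ℝ))
      ≤ √(Fintype.card X * Real.exp (-(Φ ^ 2 / 8) * t)) := by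
  refine (tvDist_le_sqrt _ _).trans (Real.sqrt_le_sqrt ?_)
  refine mul_le_mul_of_nonneg_left ?_ (Nat.cast_nonneg _)
  obtain ⟨h0, h1⟩ := sum_sub_uniform_sq_le σ hσ
  have h := (sum_vecMul_pow_sq_le_exp P Φ hΦ hP hrow hcol hlazy hcut
    (σ - fun _ => 1 / (Fintype.card X : ℝ)) h0 t).2
  have hu : Matrix.vecMul (fun _ => 1 / (Fintype.card X : ℝ)) (P ^ t)
      = fun _ => 1 / (Fintype.card X : ℝ) := by
    induction t with
    | zero => simp
    | succ t ih => rw [pow_succ', ← Matrix.vecMul_vecMul, vecMul_uniform P hcol,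
        ih (sum_vecMul_pow_sq_le_exp P Φ hΦ hP hrow hcol hlazy hcut _ h0 t).2]
  rw [Matrix.sub_vecMul, hu] at h
  exact h.trans (mul_le_of_le_one_right (Real.exp_pos _).le h1)

theorem exists_hasMixingTime (P : Matrix X X ℝ) (π : X → ℝ) (hπ : IsUniqueStationary P π) (ε : ℝ)
    (σ : X → ℝ) (hσ : σ ∈ stdSimplex ℝ X) (t₀ t₁ : ℕ)
    (hup : ∀ τ ∈ stdSimplex ℝ X, tvDist (Matrix.vecMul τ (P ^ t₁)) π ≤ ε)
    (hlow : ∀ t ≤ t₀, ε < tvDist (Matrix.vecMul σ (P ^ t)) π) :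
    ∃ T : ℕ, HasMixingTime P ε T ∧ t₀ < T ∧ T ≤ t₁ := by
  have h1 : mixingTimeTo P π ε ≤ (t₁ : ℕ∞) :=
    iSup₂_le fun τ hτ => iInf₂_le t₁ (hup τ hτ)
  obtain ⟨T, hT⟩ := ENat.ne_top_iff_exists.1 (ne_top_of_le_ne_top (ENat.natCast_ne_top _) h1)
  refine ⟨T, ⟨π, hπ, hT.symm⟩, ?_, by rw [← hT] at h1; exact_mod_cast h1⟩
  have h2 : ((t₀ + 1 : ℕ) : ℕ∞) ≤ mixingTimeTo P π ε := by
    refine le_trans ?_ (le_iSup₂ (f := fun σ _ => ⨅ t : ℕ,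
      ⨅ _ : tvDist (Matrix.vecMul σ (P ^ t)) π ≤ ε, (t : ℕ∞)) σ hσ)
    refine le_iInf₂ fun t ht => ?_
    have : t₀ + 1 ≤ t := by
      by_contra hc
      exact absurd ht (not_le.2 (hlow t (by omega)))
    exact_mod_cast this
  rw [← hT] at h2
  exact_mod_cast h2

end Cheeger

/-! ### Estimates for binomial coefficients -/

section Choose

theorem div_pow_le_choose (r k : ℕ) (h : r ≤ k) : ((k : ℝ) / r) ^ r ≤ k.choose r := by
  induction r generalizing k with
  | zero => simp
  | succ r ih =>
    obtain ⟨k, rfl⟩ : ∃ k', k = k' + 1 := ⟨k - 1, by omega⟩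
    have h1 := ih k (by omega)
    have h2 : ((k + 1 : ℕ) : ℝ) * (k.choose r : ℝ) = ((k + 1).choose (r + 1) : ℝ) * (r + 1 : ℕ) := by
      exact_mod_cast Nat.add_one_mul_choose_eq k r
    have hr : (0 : ℝ) < ((r + 1 : ℕ) : ℝ) := by positivity
    have h3 : ((k + 1).choose (r + 1) : ℝ) = ((k + 1 : ℕ) : ℝ) / (r + 1 : ℕ) * k.choose r := by
      field_simp; linarith
    rw [h3, pow_succ, mul_comm]
    refine mul_le_mul_of_nonneg_left (le_trans ?_ h1) (by positivity)
    rcases Nat.eq_zero_or_pos r with rfl | hr0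
    · simp
    · have hr0' : (0 : ℝ) < r := by exact_mod_cast hr0
      refine pow_le_pow_left₀ (by positivity) ?_ r
      rw [div_le_div_iff₀ hr hr0']
      have : (r : ℝ) ≤ k := by exact_mod_cast (by omega : r ≤ k)
      push_cast
      nlinarith

theorem choose_le_choose_of_le_half {k a b : ℕ} (hab : a ≤ b) (hb : 2 * b ≤ k) :
    k.choose a ≤ k.choose b := by
  induction b, hab using Nat.le_induction with
  | base => exact le_rfl
  | succ b _ ih =>
    exact (ih (by omega)).trans (Nat.choose_le_succ_of_lt_half_left (by omega))

theorem choose_sq_le_choose_two_mul (k p : ℕ) : k.choose p ^ 2 ≤ (2 * k).choose (2 * p) := by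
  rw [two_mul k, Nat.add_choose_eq, sq]
  exact single_le_sum (f := fun ij : ℕ × ℕ => k.choose ij.1 * k.choose ij.2)
    (fun _ _ => Nat.zero_le _) (mem_antidiagonal.2 (two_mul p).symm : (p, p) ∈ antidiagonal (2 * p))

theorem choose_le_div_pow (b m : ℕ) : (m.choose b : ℝ) ≤ (3 * m / b) ^ b := by
  rcases Nat.eq_zero_or_pos b with rfl | hb
  · simp
  have hb' : (0 : ℝ) < b := by exact_mod_cast hb
  have hf : (0 : ℝ) < b.factorial := by exact_mod_cast b.factorial_pos
  have h1 : (b : ℝ) ^ b / b.factorial ≤ 3 ^ b := by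
    refine (Real.pow_div_factorial_le_exp (b : ℝ) hb'.le b).trans ?_
    rw [← mul_one (b : ℝ), Real.exp_nat_mul]
    exact pow_le_pow_left₀ (Real.exp_pos _).le Real.exp_one_lt_three.le b
  refine (Nat.choose_le_pow_div b m).trans ?_
  rw [div_le_iff₀ hf] at h1 ⊢
  rw [div_pow, mul_pow, div_mul_eq_mul_div, le_div_iff₀ (by positivity)]
  have : (0 : ℝ) ≤ (m : ℝ) ^ b := by positivity
  nlinarith

theorem choose_div_choose_le (k b : ℕ) (hb : 1 ≤ b) (hbk : 40 * b ≤ k) :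
    ((2 * k).choose b : ℝ) / k.choose (20 * b) ≤ (20 / k) ^ 2 := by
  have hb' : (1 : ℝ) ≤ b := by exact_mod_cast hb
  have hk' : (40 : ℝ) * b ≤ k := by exact_mod_cast hbk
  have hk : (0 : ℝ) < k := by linarith
  -- In terms of `y ≥ 2` the numerator is at most `(120 y)^b` and the denominator at least `y^(20
  -- b)`. Since `120 ≤ 2^15`, a factor `y^(4 b)` remains to spare, and `y^(2 b) ≥ y * b = k / 20`.
  set y : ℝ := k / (20 * b : ℕ) with hy
  have hyk : y * (20 * b) = k := by rw [hy]; push_cast; field_simp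
  have hy2 : 2 ≤ y := by
    rw [hy, le_div_iff₀ (by positivity)]; push_cast; linarith
  have h1 : ((2 * k).choose b : ℝ) ≤ (120 * y) ^ b := by
    refine (choose_le_div_pow b (2 * k)).trans (le_of_eq ?_)
    congr 1
    rw [hy]; push_cast; field_simp; ring
  have h2 : y ^ (20 * b) ≤ (k.choose (20 * b) : ℝ) := div_pow_le_choose _ _ (by omega)
  have h3 : (120 * y) * y ^ 4 ≤ y ^ 20 := by
    have : (2 : ℝ) ^ 15 ≤ y ^ 15 := pow_le_pow_left₀ (by norm_num) hy2 15
    have e : y ^ 20 = y ^ 15 * y ^ 5 := by ring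
    rw [e]
    have : (0 : ℝ) ≤ y ^ 5 := by positivity
    nlinarith
  have h4 : (k : ℝ) / 20 ≤ y ^ (2 * b) := by
    have a1 : (b : ℝ) ≤ 2 ^ b := by exact_mod_cast Nat.lt_two_pow_self.le
    have a2 : (2 : ℝ) ^ b ≤ y ^ b := pow_le_pow_left₀ (by norm_num) hy2 b
    have a3 : y ≤ y ^ b := le_self_pow₀ (by linarith) (by omega)
    rw [two_mul, pow_add]
    calc (k : ℝ) / 20 = y * b := by rw [← hyk]; ring
      _ ≤ y ^ b * y ^ b := mul_le_mul a3 (a1.trans a2) (by positivity) (by positivity)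
  have h5 : (120 * y) ^ b * ((k : ℝ) / 20) ^ 2 ≤ k.choose (20 * b) := by
    calc (120 * y) ^ b * ((k : ℝ) / 20) ^ 2 ≤ (120 * y) ^ b * (y ^ (2 * b)) ^ 2 := by gcongr
      _ = ((120 * y) * y ^ 4) ^ b := by rw [mul_pow _ (y ^ 4), ← pow_mul, ← pow_mul]; ring_nf
      _ ≤ (y ^ 20) ^ b := pow_le_pow_left₀ (by positivity) h3 b
      _ = y ^ (20 * b) := by rw [pow_mul]
      _ ≤ _ := h2
  have hpos : (0 : ℝ) < k.choose (20 * b) := by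
    exact_mod_cast Nat.choose_pos (by omega)
  rw [div_le_iff₀ hpos]
  calc ((2 * k).choose b : ℝ) ≤ (120 * y) ^ b := h1
    _ = (20 / k) ^ 2 * ((120 * y) ^ b * ((k : ℝ) / 20) ^ 2) := by field_simp
    _ ≤ _ := mul_le_mul_of_nonneg_left h5 (by positivity)

end Choose

/-! ### Edge boundaries on a path -/

section PathBoundary

variable {m : ℕ}

/-- The edges `{i, i + 1}` of the path `0, …, m - 1` with exactly one end in `A`, each given by
its lower end. -/
def pathBoundary (A : Finset (Fin m)) : Finset (Fin m) :=
  {i | ∃ j : Fin m, (j : ℕ) = i + 1 ∧ ¬(i ∈ A ↔ j ∈ A)}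

theorem mem_pathBoundary {A : Finset (Fin m)} {i : Fin m} :
    i ∈ pathBoundary A ↔ ∃ j : Fin m, (j : ℕ) = i + 1 ∧ ¬(i ∈ A ↔ j ∈ A) := by
  simp [pathBoundary]

theorem eq_of_pathBoundary_eq (hm : 0 < m) {A B : Finset (Fin m)}
    (h : pathBoundary A = pathBoundary B)
    (h0 : (⟨0, hm⟩ : Fin m) ∈ A ↔ (⟨0, hm⟩ : Fin m) ∈ B) : A = B := by
  have key : ∀ i : ℕ, ∀ hi : i < m, (⟨i, hi⟩ : Fin m) ∈ A ↔ (⟨i, hi⟩ : Fin m) ∈ B := by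
    intro i
    induction i with
    | zero => exact fun _ => h0
    | succ i ih =>
      intro hi
      have h1 := ih (by omega)
      have h2 : (⟨i, by omega⟩ : Fin m) ∈ pathBoundary A ↔ (⟨i, by omega⟩ : Fin m) ∈ pathBoundary B := by
        rw [h]
      have h3 : ∀ C : Finset (Fin m), (⟨i, by omega⟩ : Fin m) ∈ pathBoundary C ↔
          ¬((⟨i, by omega⟩ : Fin m) ∈ C ↔ (⟨i + 1, hi⟩ : Fin m) ∈ C) := fun C => by
        rw [mem_pathBoundary]
        constructor
        · rintro ⟨j, hj, hij⟩
          obtain rfl : j = ⟨i + 1, hi⟩ := Fin.ext hj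
          exact hij
        · exact fun hij => ⟨⟨i + 1, hi⟩, rfl, hij⟩
      rw [h3, h3] at h2
      tauto
  ext i
  exact key i i.2

theorem pathBoundary_compl (A : Finset (Fin m)) : pathBoundary Aᶜ = pathBoundary A := by
  ext i
  simp only [mem_pathBoundary, mem_compl, not_iff_not]

theorem pathBoundary_nonempty {A : Finset (Fin m)} (h1 : A.Nonempty) (h2 : A ≠ univ) :
    (pathBoundary A).Nonempty := by
  obtain ⟨i, hi⟩ := h1
  have hm : 0 < m := by have := i.2; omega
  by_contra hne
  rw [not_nonempty_iff_eq_empty] at hne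
  have e1 : pathBoundary (univ : Finset (Fin m)) = ∅ := by ext; simp [mem_pathBoundary]
  have e2 : pathBoundary (∅ : Finset (Fin m)) = ∅ := by ext; simp [mem_pathBoundary]
  by_cases h0 : (⟨0, hm⟩ : Fin m) ∈ A
  · exact h2 (eq_of_pathBoundary_eq hm (hne.trans e1.symm) (by simp [h0]))
  · have := eq_of_pathBoundary_eq hm (hne.trans e2.symm) (by simp [h0])
    simp [this] at hi

/-- A set is recovered from its boundary and from whether it contains 0, the latter being the factor
2. -/
theorem card_pathBoundary_eq_le (hm : 0 < m) (b : ℕ) :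
    #{A : Finset (Fin m) | #(pathBoundary A) = b} ≤ 2 * m.choose b := by
  have : #(powersetCard b (univ : Finset (Fin m)) ×ˢ (univ : Finset Bool)) = 2 * m.choose b := by
    simp [mul_comm]
  rw [← this]
  refine card_le_card_of_injOn (fun A => (pathBoundary A, decide ((⟨0, hm⟩ : Fin m) ∈ A))) ?_ ?_
  · intro A hA
    have : #(pathBoundary A) = b := by simpa using hA
    simp [mem_powersetCard, this, em]
  · intro A _ B _ hAB
    obtain ⟨h1, h2⟩ := Prod.mk.inj hAB
    exact eq_of_pathBoundary_eq hm h1 (by simpa using h2)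

end PathBoundary

/-! ### Expansion of a random perfect matching -/

section Matching

variable {m : ℕ}

theorem mem_perfectMatchings {s : Equiv.Perm (Fin m)} :
    s ∈ perfectMatchings m ↔ ∀ i, s i ≠ i ∧ s (s i) = i := by
  simp [perfectMatchings]

theorem perfectMatchings_nonempty (k : ℕ) : (perfectMatchings (2 * k)).Nonempty := by
  refine ⟨Fin.revPerm, mem_perfectMatchings.2 fun i => ⟨fun h => ?_, by simp⟩⟩
  have := congrArg Fin.val h
  simp [Fin.val_rev] at this
  omega

theorem two_mul_card_filter_lt {s : Equiv.Perm (Fin m)} (hs : s ∈ perfectMatchings m)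
    {U : Finset (Fin m)} (hU : ∀ i ∈ U, s i ∈ U) : 2 * #{i ∈ U | i < s i} = #U := by
  rw [mem_perfectMatchings] at hs
  have h1 : #{i ∈ U | i < s i} = #{i ∈ U | ¬ i < s i} := by
    refine card_bij' (fun i _ => s i) (fun i _ => s i) ?_ ?_ ?_ ?_
    · intro i hi
      obtain ⟨hi, hlt⟩ := mem_filter.1 hi
      refine mem_filter.2 ⟨hU i hi, ?_⟩
      rw [(hs i).2]; exact not_lt.2 hlt.le
    · intro i hi
      obtain ⟨hi, hlt⟩ := mem_filter.1 hi
      refine mem_filter.2 ⟨hU i hi, ?_⟩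
      rw [(hs i).2]; exact lt_of_le_of_ne (not_lt.1 hlt) (hs i).1
    · exact fun i _ => (hs i).2
    · exact fun i _ => (hs i).2
  have h2 := card_filter_add_card_filter_not (s := U) (fun i => i < s i)
  omega

/-- A closed set is a union of matched pairs, hence determined by the `p` lower ends of its pairs
among the `k` lower ends available. -/
theorem card_closed_le {k : ℕ} {s : Equiv.Perm (Fin (2 * k))} (hs : s ∈ perfectMatchings (2 * k))
    (p : ℕ) :
    #{U ∈ powersetCard (2 * p) (univ : Finset (Fin (2 * k))) | ∀ i ∈ U, s i ∈ U} ≤ k.choose p := by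
  have hR : #{i : Fin (2 * k) | i < s i} = k := by
    have := two_mul_card_filter_lt hs (U := univ) (by simp)
    simp only [card_univ, Fintype.card_fin] at this
    omega
  have hc : #(powersetCard p ({i : Fin (2 * k) | i < s i} : Finset _)) = k.choose p := by
    rw [card_powersetCard, hR]
  rw [← hc]
  refine card_le_card_of_injOn (fun U => U.filter fun i => i < s i) ?_ ?_
  · intro U hU
    obtain ⟨hU1, hU2⟩ := mem_filter.1 hU
    have := two_mul_card_filter_lt hs hU2
    rw [(mem_powersetCard.1 hU1).2] at this
    refine mem_powersetCard.2 ⟨filter_subset_filter _ (subset_univ _), ?_⟩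
    change #{i ∈ U | i < s i} = p
    omega
  · intro U hU V hV hUV
    have hU2 := (mem_filter.1 hU).2
    have hV2 := (mem_filter.1 hV).2
    rw [mem_perfectMatchings] at hs
    have hmem : ∀ i, i < s i → (i ∈ U ↔ i ∈ V) := fun i hi => by
      have := congrArg (i ∈ ·) hUV
      simpa [hi] using this
    ext i
    rcases lt_trichotomy i (s i) with h | h | h
    · exact hmem i h
    · exact absurd h.symm (hs i).1
    · have h1 := hmem (s i) (by rw [(hs i).2]; exact h)
      have eU : i ∈ U ↔ s i ∈ U := ⟨hU2 i, fun h => by simpa [(hs i).2] using hU2 _ h⟩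
      have eV : i ∈ V ↔ s i ∈ V := ⟨hV2 i, fun h => by simpa [(hs i).2] using hV2 _ h⟩
      rw [eU, eV, h1]

/-- Conjugation by a permutation carrying `U` to `V` preserves the matchings. -/
theorem card_matchings_closed_le {U V : Finset (Fin m)} (h : #U = #V) :
    #{s ∈ perfectMatchings m | ∀ i ∈ U, s i ∈ U} ≤ #{s ∈ perfectMatchings m | ∀ i ∈ V, s i ∈ V} := by
  set e : Equiv.Perm (Fin m) := (Finset.equivOfCardEq h).extendSubtype with he
  have heU : ∀ i, e i ∈ V ↔ i ∈ U := fun i => by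
    constructor
    · intro hi
      by_contra hiU
      exact (Finset.equivOfCardEq h).extendSubtype_not_mem i hiU hi
    · exact fun hi => (Finset.equivOfCardEq h).extendSubtype_mem i hi
  refine card_le_card_of_injOn (fun s => e * s * e⁻¹) ?_ ?_
  · intro s hs
    obtain ⟨hs1, hs2⟩ := mem_filter.1 hs
    rw [mem_perfectMatchings] at hs1
    refine mem_filter.2 ⟨mem_perfectMatchings.2 fun i => ⟨fun hi => ?_, ?_⟩, fun i hi => ?_⟩
    · apply (hs1 (e⁻¹ i)).1
      apply e.injective
      simpa using hi
    · simp [(hs1 _).2]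
    · have h1 : e⁻¹ i ∈ U := (heU _).1 (by simpa using hi)
      simpa [heU] using hs2 _ h1
  · intro s _ t _ hst
    simpa using hst

/-- Pairs of a matching and a closed set of size `2p` are counted in two ways. By symmetry all sets
of this size are closed for equally many matchings, so `U` is closed with probability at most `(k
choose p) / (2k choose 2p)`, which is at most `1 / (k choose p)` by Vandermonde. -/
theorem card_matchings_closed_mul_choose_le {k p : ℕ} {U : Finset (Fin (2 * k))} (hU : #U = 2 * p) :
    #{s ∈ perfectMatchings (2 * k) | ∀ i ∈ U, s i ∈ U} * k.choose p ≤ #(perfectMatchings (2 * k)) := by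
  set N := #{s ∈ perfectMatchings (2 * k) | ∀ i ∈ U, s i ∈ U} with hN
  have h1 : (2 * k).choose (2 * p) * N ≤ #(perfectMatchings (2 * k)) * k.choose p := by
    calc (2 * k).choose (2 * p) * N
        = ∑ V ∈ powersetCard (2 * p) (univ : Finset (Fin (2 * k))), N := by simp
      _ ≤ ∑ V ∈ powersetCard (2 * p) (univ : Finset (Fin (2 * k))),
          #{s ∈ perfectMatchings (2 * k) | ∀ i ∈ V, s i ∈ V} :=
        sum_le_sum fun V hV => card_matchings_closed_le (hU.trans (mem_powersetCard.1 hV).2.symm)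
      _ = ∑ s ∈ perfectMatchings (2 * k),
          #{V ∈ powersetCard (2 * p) (univ : Finset (Fin (2 * k))) | ∀ i ∈ V, s i ∈ V} :=
        sum_card_bipartiteAbove_eq_sum_card_bipartiteBelow _
      _ ≤ ∑ s ∈ perfectMatchings (2 * k), k.choose p := sum_le_sum fun s hs => card_closed_le hs p
      _ = _ := by simp
  have hpk : p ≤ k := by
    have := card_le_univ U
    rw [Fintype.card_fin] at this
    omega
  have h2 := choose_sq_le_choose_two_mul k p
  have h3 : 0 < k.choose p := Nat.choose_pos hpk
  have h4 : k.choose p * (N * k.choose p) ≤ k.choose p * #(perfectMatchings (2 * k)) := by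
    calc k.choose p * (N * k.choose p) = k.choose p ^ 2 * N := by ring
      _ ≤ (2 * k).choose (2 * p) * N := Nat.mul_le_mul_right _ h2
      _ ≤ _ := h1.trans (le_of_eq (mul_comm _ _))
  exact Nat.le_of_mul_le_mul_left h4 h3

/-- The matching `s` together with the path `0, …, 2k - 1` expands well: this is asked for sets
which are unions of matched pairs. -/
def IsExpanding (k : ℕ) (s : Equiv.Perm (Fin (2 * k))) : Prop :=
  ∀ U : Finset (Fin (2 * k)), U.Nonempty → #U ≤ k → (∀ i ∈ U, s i ∈ U) → #U < 40 * #(pathBoundary U)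

open Classical in
theorem card_not_isExpanding_le (k : ℕ) (hk : 0 < k) :
    (#{s ∈ perfectMatchings (2 * k) | ¬IsExpanding k s} : ℝ)
      ≤ 800 / k * #(perfectMatchings (2 * k)) := by
  set M : ℝ := ((#(perfectMatchings (2 * k)) : ℕ) : ℝ) with hM
  set 𝒰 : Finset (Finset (Fin (2 * k))) :=
    {U | U.Nonempty ∧ #U ≤ k ∧ 40 * #(pathBoundary U) ≤ #U} with h𝒰
  set N : Finset (Fin (2 * k)) → ℕ := fun U => #{s ∈ perfectMatchings (2 * k) | ∀ i ∈ U, s i ∈ U}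
  have hk' : (0 : ℝ) < k := by exact_mod_cast hk
  have h1 : #{s ∈ perfectMatchings (2 * k) | ¬IsExpanding k s} ≤ ∑ U ∈ 𝒰, N U := by
    refine le_trans (card_le_card fun s hs => ?_) card_biUnion_le
    obtain ⟨hs1, hs2⟩ := mem_filter.1 hs
    simp only [IsExpanding, not_forall, not_lt] at hs2
    obtain ⟨U, hU1, hU2, hU3, hU4⟩ := hs2
    exact mem_biUnion.2 ⟨U, by simp [h𝒰, hU1, hU2, hU4], mem_filter.2 ⟨hs1, hU3⟩⟩
  have h2 : ∀ U ∈ 𝒰, (N U : ℝ) ≤ M / k.choose (20 * #(pathBoundary U)) := fun U hU => by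
    obtain ⟨hU1, hU2, hU3⟩ : U.Nonempty ∧ #U ≤ k ∧ 40 * #(pathBoundary U) ≤ #U := by
      simpa [h𝒰] using hU
    rcases Nat.eq_zero_or_pos (N U) with h0 | h0
    -- This case covers the sets of odd size, which no matching leaves closed.
    · rw [h0]; simp; positivity
    · obtain ⟨s, hs⟩ := card_pos.1 h0
      obtain ⟨hs1, hs2⟩ := mem_filter.1 hs
      have e := two_mul_card_filter_lt hs1 hs2
      set p := #{i ∈ U | i < s i}
      have h3 := card_matchings_closed_mul_choose_le e.symm
      have h4 : k.choose (20 * #(pathBoundary U)) ≤ k.choose p :=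
        choose_le_choose_of_le_half (by omega) (by omega)
      have h5 : 0 < k.choose (20 * #(pathBoundary U)) := Nat.choose_pos (by omega)
      rw [le_div_iff₀ (by exact_mod_cast h5), hM]
      exact_mod_cast (Nat.mul_le_mul_left _ h4).trans h3
  have h3 : ∀ U ∈ 𝒰, #(pathBoundary U) ∈ (range k).filter fun b => 1 ≤ b ∧ 40 * b ≤ k := fun U hU => by
    obtain ⟨hU1, hU2, hU3⟩ : U.Nonempty ∧ #U ≤ k ∧ 40 * #(pathBoundary U) ≤ #U := by
      simpa [h𝒰] using hU
    have := (pathBoundary_nonempty hU1 (fun h => by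
      rw [h, card_univ, Fintype.card_fin] at hU2; omega)).card_pos
    simp only [mem_filter, mem_range]
    omega
  calc (#{s ∈ perfectMatchings (2 * k) | ¬IsExpanding k s} : ℝ) ≤ ∑ U ∈ 𝒰, (N U : ℝ) := by
        exact_mod_cast h1
    _ ≤ ∑ U ∈ 𝒰, M / k.choose (20 * #(pathBoundary U)) := sum_le_sum h2
    _ = ∑ b ∈ (range k).filter fun b => 1 ≤ b ∧ 40 * b ≤ k,
        ∑ U ∈ 𝒰 with #(pathBoundary U) = b, M / k.choose (20 * #(pathBoundary U)) :=
      (sum_fiberwise_of_maps_to h3 _).symm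
    -- Each boundary size contributes `O(1 / k²)`, and there are at most `k` sizes.
    _ ≤ ∑ b ∈ (range k).filter fun b => 1 ≤ b ∧ 40 * b ≤ k, 2 * M * (20 / k) ^ 2 := by
      refine sum_le_sum fun b hb => ?_
      obtain ⟨-, hb1, hb2⟩ := mem_filter.1 hb
      have e : ∑ U ∈ 𝒰 with #(pathBoundary U) = b, M / k.choose (20 * #(pathBoundary U))
          = #{U ∈ 𝒰 | #(pathBoundary U) = b} * (M / k.choose (20 * b)) := by
        rw [← nsmul_eq_mul, ← sum_const]
        exact sum_congr rfl fun U hU => by rw [(mem_filter.1 hU).2]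
      have c : (#{U ∈ 𝒰 | #(pathBoundary U) = b} : ℝ) ≤ 2 * (2 * k).choose b := by
        exact_mod_cast (card_le_card (filter_subset_filter _ (subset_univ _))).trans
          (card_pathBoundary_eq_le (by omega) b)
      rw [e]
      calc (#{U ∈ 𝒰 | #(pathBoundary U) = b} : ℝ) * (M / k.choose (20 * b))
          ≤ (2 * (2 * k).choose b) * (M / k.choose (20 * b)) :=
            mul_le_mul_of_nonneg_right c (by positivity)
        _ = 2 * M * ((2 * k).choose b / k.choose (20 * b)) := by ring
        _ ≤ _ := mul_le_mul_of_nonneg_left (choose_div_choose_le k b hb1 hb2) (by positivity)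
    _ ≤ k * (2 * M * (20 / k) ^ 2) := by
      rw [sum_const, nsmul_eq_mul]
      refine mul_le_mul_of_nonneg_right ?_ (by positivity)
      exact_mod_cast (card_filter_le _ _).trans (card_range k).le
    _ = _ := by field_simp; ring

/-- Expansion is applied to the closed part `U` of `A`. Each of the `c` deleted points touches at
most two path edges, so the boundary grows by at most `2c`; then `40 * 2c + c = 81c`. -/
theorem IsExpanding.card_le {k : ℕ} {s : Equiv.Perm (Fin (2 * k))} (h : IsExpanding k s)
    (hs : s ∈ perfectMatchings (2 * k)) (A : Finset (Fin (2 * k))) (hA : #A ≤ k) :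
    #A ≤ 81 * (#(pathBoundary A) + #{i ∈ A | s i ∉ A}) := by
  rw [mem_perfectMatchings] at hs
  set U := A.filter fun i => s i ∈ A with hU
  set c := #{i ∈ A | s i ∉ A} with hc
  have h1 : #U + c = #A := card_filter_add_card_filter_not (s := A) _
  rcases U.eq_empty_or_nonempty with h0 | h0
  · rw [h0, card_empty] at h1; omega
  have h2 := h U h0 (by omega) (fun i hi => by
    obtain ⟨hi1, hi2⟩ := mem_filter.1 hi
    exact mem_filter.2 ⟨hi2, by rwa [(hs i).2]⟩)
  have h3 : #(pathBoundary U) ≤ #(pathBoundary A) + c + c := by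
    set pre : Finset (Fin (2 * k)) :=
      {i | ∃ j : Fin (2 * k), (j : ℕ) = i + 1 ∧ j ∈ A.filter fun i => s i ∉ A}
    have hpre : #pre ≤ c := by
      -- The truncated value at `j = 0` is harmless: only the points `j = i + 1` are needed for
      -- surjectivity.
      refine card_le_card_of_surjOn (fun j => ⟨j - 1, by omega⟩) fun i hi => ?_
      obtain ⟨j, hj, hj'⟩ := (mem_filter.1 hi).2
      exact ⟨j, hj', Fin.ext (by simp [hj])⟩
    have hsub : pathBoundary U ⊆ pathBoundary A ∪ A.filter (fun i => s i ∉ A) ∪ pre := by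
      intro i hi
      obtain ⟨j, hj, hij⟩ := mem_pathBoundary.1 hi
      simp only [mem_union, mem_pathBoundary, mem_filter, mem_univ, true_and, pre]
      by_contra hcon
      push Not at hcon
      obtain ⟨⟨g1, g2⟩, g3⟩ := hcon
      have := g1 j hj
      have := g3 j hj
      simp only [hU, mem_filter] at hij
      tauto
    refine (card_le_card hsub).trans ((card_union_le _ _).trans ?_)
    exact Nat.add_le_add (card_union_le _ _) hpre
  omega

theorem IsExpanding.min_card_le {k : ℕ} {s : Equiv.Perm (Fin (2 * k))} (h : IsExpanding k s)
    (hs : s ∈ perfectMatchings (2 * k)) (A : Finset (Fin (2 * k))) :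
    min (#A) (#Aᶜ) ≤ 81 * (#(pathBoundary A) + #{i ∈ A | s i ∉ A}) := by
  have hcard := card_add_card_compl A
  rw [Fintype.card_fin] at hcard
  rcases le_or_gt #A k with hA | hA
  · exact (min_le_left _ _).trans (h.card_le hs A hA)
  · have := h.card_le hs Aᶜ (by omega)
    rw [pathBoundary_compl] at this
    refine (min_le_right _ _).trans (this.trans ?_)
    refine Nat.mul_le_mul_left _ (Nat.add_le_add_left ?_ _)
    rw [mem_perfectMatchings] at hs
    refine card_le_card_of_injOn s (fun i hi => ?_) s.injective.injOn
    obtain ⟨hi1, hi2⟩ := mem_filter.1 hi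
    refine mem_filter.2 ⟨by simpa using hi2, ?_⟩
    rw [(hs i).2]
    simpa using hi1

end Matching

/-! ### Cutting an interval of integers into blocks -/

section Intervals

variable (p : ℕ → Prop) [DecidablePred p]

theorem iff_of_no_change (p : ℕ → Prop) {a b : ℕ} (h : ∀ j ∈ Ico a b, (p j ↔ p (j + 1))) (hab : a ≤ b) :
    p a ↔ p b := by
  induction b, hab using Nat.le_induction with
  | base => exact Iff.rfl
  | succ b hab ih =>
    rw [ih fun j hj => h j (Ico_subset_Ico_right b.le_succ hj)]
    exact h b (by simp [hab])

/-- If `p` fails at `a` and never changes on the block, it holds nowhere there. Otherwise the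
bracket is at least 1 and pays for the whole length. -/
theorem card_Ico_filter_le {a b D : ℕ} (hD : b ≤ a + D) :
    #{j ∈ Ico a b | p j} ≤ D * ((if p a then 1 else 0) + #{j ∈ Ico a b | ¬(p j ↔ p (j + 1))}) := by
  by_cases h : p a ∨ ({j ∈ Ico a b | ¬(p j ↔ p (j + 1))} : Finset ℕ).Nonempty
  · have h1 : 1 ≤ (if p a then 1 else 0) + #{j ∈ Ico a b | ¬(p j ↔ p (j + 1))} := by
      rcases h with h | h
      · simp [h]
      · exact le_add_left h.card_pos
    have h2 := card_filter_le (Ico a b) p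
    rw [Nat.card_Ico] at h2
    exact (h2.trans (by omega)).trans (Nat.le_mul_of_pos_right D h1)
  · rw [not_or, not_nonempty_iff_eq_empty] at h
    obtain ⟨h1, h2⟩ := h
    have h3 : ({j ∈ Ico a b | p j} : Finset ℕ) = ∅ := filter_eq_empty_iff.2 fun j hj hpj => h1 <| by
      obtain ⟨hj1, hj2⟩ := mem_Ico.1 hj
      refine (iff_of_no_change p (fun i hi => ?_) hj1).2 hpj
      by_contra hc
      have : i ∈ ({j ∈ Ico a b | ¬(p j ↔ p (j + 1))} : Finset ℕ) :=
        mem_filter.2 ⟨Ico_subset_Ico_right hj2.le hi, hc⟩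
      simp [h2] at this
    rw [h3]; simp

theorem card_range_filter_add (q : ℕ → Prop) [DecidablePred q] {a b : ℕ} (hab : a ≤ b) :
    #{j ∈ range b | q j} = #{j ∈ range a | q j} + #{j ∈ Ico a b | q j} := by
  rw [← card_union_of_disjoint, ← filter_union, range_eq_Ico, range_eq_Ico,
    Ico_union_Ico_eq_Ico (Nat.zero_le _) hab]
  refine disjoint_filter_filter ?_
  rw [range_eq_Ico]
  exact Ico_disjoint_Ico_consecutive 0 a b

variable {w : ℕ → ℕ} (hw : Monotone w)
include hw

theorem card_filter_range_le {D : ℕ} (hw0 : w 0 = 0) (hD : ∀ i, w (i + 1) ≤ w i + D) (m : ℕ) :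
    #{j ∈ range (w m) | p j}
      ≤ D * (#{i ∈ range m | p (w i)} + #{j ∈ range (w m) | ¬(p j ↔ p (j + 1))}) := by
  induction m with
  | zero => simp [hw0]
  | succ m ih =>
    have hm := hw m.le_succ
    rw [card_range_filter_add _ hm, card_range_filter_add (fun j => ¬(p j ↔ p (j + 1))) hm,
      range_add_one, filter_insert]
    have h1 := card_Ico_filter_le p (hD m)
    have h2 : #(if p (w m) then insert m ({i ∈ range m | p (w i)} : Finset ℕ) else {i ∈ range m | p (w i)})
        = #{i ∈ range m | p (w i)} + if p (w m) then 1 else 0 := by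
      split_ifs
      · rw [card_insert_of_notMem (by simp)]
      · simp
    rw [h2]
    refine (Nat.add_le_add ih h1).trans (le_of_eq ?_)
    ring

theorem card_change_le (m : ℕ) :
    #{i ∈ range m | ¬(p (w i) ↔ p (w (i + 1)))} ≤ #{j ∈ range (w m) | ¬(p j ↔ p (j + 1))} := by
  induction m with
  | zero => simp
  | succ m ih =>
    have hm := hw m.le_succ
    rw [card_range_filter_add (fun j => ¬(p j ↔ p (j + 1))) hm, range_add_one, filter_insert]
    split_ifs with h
    · exact ih.trans (Nat.le_add_right _ _)
    · refine (card_insert_le _ _).trans (Nat.add_le_add ih (card_pos.2 ?_))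
      by_contra hne
      rw [not_nonempty_iff_eq_empty, filter_eq_empty_iff] at hne
      exact h (iff_of_no_change p (fun j hj => not_not.1 (hne hj)) hm)

end Intervals

/-! ### Transfer of expansion from the path to the cycle -/

section Cycle

variable {n : ℕ} [NeZero n]

theorem add_one_mod_eq_iff (x y : Fin n) : ((x : ℕ) + 1) % n = y ↔ x + 1 = y := by
  rw [Fin.ext_iff, Fin.val_add, Fin.val_one', Nat.add_mod_mod]

/-- The nodes `x` of the cycle for which exactly one of `x` and `x + 1` is in `S`. -/
def cycleBoundary (S : Finset (Fin n)) : Finset (Fin n) :=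
  {x | ¬(x ∈ S ↔ x + 1 ∈ S)}

theorem cycleBoundary_compl (S : Finset (Fin n)) : cycleBoundary Sᶜ = cycleBoundary S := by
  ext x
  simp [cycleBoundary, not_iff_not]

theorem card_leaving_eq (S : Finset (Fin n)) :
    #{x ∈ S | x + 1 ∉ S} = #{x ∈ Sᶜ | x + 1 ∈ S} := by
  have h1 := card_filter_add_card_filter_not (s := S) (fun x => x + 1 ∈ S)
  have h2 : #{x : Fin n | x + 1 ∈ S} = #S := by
    refine card_bij (fun x _ => x + 1) (by simp) (by simp) fun y hy => ⟨y - 1, by simpa using hy, by simp⟩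
  have h3 : #{x : Fin n | x + 1 ∈ S} = #{x ∈ S | x + 1 ∈ S} + #{x ∈ Sᶜ | x + 1 ∈ S} := by
    rw [← card_union_of_disjoint (disjoint_filter_filter disjoint_compl_right), ← filter_union,
      union_compl]
  omega

theorem card_cycleBoundary (S : Finset (Fin n)) :
    #(cycleBoundary S) = 2 * #{x ∈ S | x + 1 ∉ S} := by
  have : cycleBoundary S = ({x ∈ S | x + 1 ∉ S} : Finset _) ∪ ({x ∈ Sᶜ | x + 1 ∈ S} : Finset _) := by
    ext x
    simp only [cycleBoundary, mem_filter, mem_univ, true_and, mem_union, mem_compl]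
    tauto
  rw [this, card_union_of_disjoint (disjoint_filter_filter disjoint_compl_right),
    ← card_leaving_eq, two_mul]

/-- The pull-back of `S` along the covering of the cycle by the natural numbers. -/
def lift (S : Finset (Fin n)) (j : ℕ) : Prop := Fin.ofNat n j ∈ S

instance (S : Finset (Fin n)) : DecidablePred (lift S) := fun j =>
  inferInstanceAs (Decidable (Fin.ofNat n j ∈ S))

theorem ofNat_add_one (j : ℕ) : Fin.ofNat n (j + 1) = Fin.ofNat n j + 1 := by
  rw [Fin.ext_iff, Fin.val_add, Fin.val_one', Nat.add_mod_mod]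
  simp [Fin.ofNat]

/-- A range of length at most `2n` winds around the cycle at most twice, so each boundary edge is
seen at most twice. -/
theorem card_range_lift_change_le (S : Finset (Fin n)) {N : ℕ} (hN : N ≤ 2 * n) :
    #{j ∈ range N | ¬(lift S j ↔ lift S (j + 1))} ≤ 2 * #(cycleBoundary S) := by
  have key : ∀ a, #{j ∈ Ico a (a + n) | ¬(lift S j ↔ lift S (j + 1))} ≤ #(cycleBoundary S) := by
    intro a
    refine card_le_card_of_injOn (fun j => Fin.ofNat n j) ?_ ?_
    · intro j hj
      have := (mem_filter.1 hj).2
      refine mem_filter.2 ⟨mem_univ _, ?_⟩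
      rw [← ofNat_add_one]
      exact this
    · intro i hi j hj hij
      have hi := mem_Ico.1 (mem_filter.1 hi).1
      have hj := mem_Ico.1 (mem_filter.1 hj).1
      have h := congrArg Fin.val hij
      simp only [Fin.ofNat] at h
      have h' : i ≡ j [MOD n] := h
      rcases le_total i j with hle | hle
      · have := (Nat.modEq_iff_dvd' hle).1 h'
        have := Nat.eq_zero_of_dvd_of_lt this (by omega)
        omega
      · have := (Nat.modEq_iff_dvd' hle).1 h'.symm
        have := Nat.eq_zero_of_dvd_of_lt this (by omega)
        omega
  have h0 := key 0
  have h1 := key n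
  refine (card_le_card (filter_subset_filter _ (range_subset_range.2 hN))).trans ?_
  rw [card_range_filter_add (fun j => ¬(lift S j ↔ lift S (j + 1))) (a := n) (by omega : n ≤ 2 * n),
    range_eq_Ico]
  rw [zero_add] at h0
  rw [← two_mul] at h1
  omega

theorem card_le_card_range_lift (S : Finset (Fin n)) {N : ℕ} (hN : n ≤ N) :
    #S ≤ #{j ∈ range N | lift S j} := by
  refine card_le_card_of_injOn (fun x => (x : ℕ)) (fun x hx => ?_) fun x _ y _ h => Fin.ext h
  refine mem_filter.2 ⟨mem_range.2 (x.2.trans_le hN), ?_⟩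
  have : Fin.ofNat n x = x := Fin.ext (Nat.mod_eq_of_lt x.2)
  rw [lift, this]
  exact hx

theorem lift_compl (S : Finset (Fin n)) (j : ℕ) : lift Sᶜ j ↔ ¬lift S j := by
  simp [lift]

/-- Expansion of a matching of nodes on the path, transferred to the cycle: `w` lists the
(unwrapped) positions of the nodes. -/
theorem card_le_of_isExpanding {k D : ℕ} (hk : 0 < k) {s : Equiv.Perm (Fin (2 * k))} (h : IsExpanding k s)
    (hs : s ∈ perfectMatchings (2 * k)) {w : ℕ → ℕ} (hw : Monotone w) (hw0 : w 0 = 0)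
    (hD : ∀ i, w (i + 1) ≤ w i + D) (hlast : n ≤ w (2 * k - 1) + D) (hN : w (2 * k - 1) ≤ 2 * n)
    (S : Finset (Fin n)) (hS : 2 * #S ≤ n) :
    #S ≤ 164 * D * (#(cycleBoundary S)
      + #{i : Fin (2 * k) | lift S (w i) ∧ ¬lift S (w (s i))}) := by
  -- A final endpoint is appended so that the blocks cover the whole cycle. The maximum is needed
  -- because the last node may lie beyond `n` before reduction.
  set w' : ℕ → ℕ := fun i => if i < 2 * k then w i else max n (w (2 * k - 1)) with hw'
  have hw'lt : ∀ i, i < 2 * k → w' i = w i := fun i hi => by simp [hw', hi]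
  have hw'ge : ∀ i, 2 * k ≤ i → w' i = max n (w (2 * k - 1)) := fun i hi => by
    simp [hw', Nat.not_lt.2 hi]
  have hmono : Monotone w' := monotone_nat_of_le_succ fun i => by
    rcases lt_trichotomy (i + 1) (2 * k) with hi | hi | hi
    · rw [hw'lt _ hi, hw'lt _ (by omega)]; exact hw i.le_succ
    · rw [hw'lt i (by omega), hw'ge _ hi.ge]
      exact (hw (by omega)).trans (le_max_right _ _)
    · rw [hw'ge _ (by omega), hw'ge _ (by omega)]
  have hD' : ∀ i, w' (i + 1) ≤ w' i + D := fun i => by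
    rcases lt_trichotomy (i + 1) (2 * k) with hi | hi | hi
    · rw [hw'lt _ hi, hw'lt _ (by omega)]; exact hD i
    · rw [hw'lt i (by omega), hw'ge _ hi.ge]
      have : i = 2 * k - 1 := by omega
      rw [this]
      exact max_le hlast (Nat.le_add_right _ _)
    · rw [hw'ge _ (by omega), hw'ge _ (by omega)]; exact Nat.le_add_right _ _
  have hw'0 : w' 0 = 0 := by rw [hw'lt _ (by omega), hw0]
  have hNk : w' (2 * k) = max n (w (2 * k - 1)) := hw'ge _ le_rfl
  have hNle : w' (2 * k) ≤ 2 * n := by rw [hNk]; exact max_le (by omega) hN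
  have hNge : n ≤ w' (2 * k) := by rw [hNk]; exact le_max_left _ _
  have nodes : ∀ R : Finset (Fin n), #{i ∈ range (2 * k) | lift R (w' i)}
      = #{i : Fin (2 * k) | lift R (w i)} := fun R => by
    symm
    refine card_bij (fun i _ => (i : ℕ)) (fun i hi => ?_) (fun i _ j _ => Fin.ext) fun j hj => ?_
    · refine mem_filter.2 ⟨mem_range.2 i.2, ?_⟩
      rw [hw'lt _ i.2]; exact (mem_filter.1 hi).2
    · obtain ⟨hj1, hj2⟩ := mem_filter.1 hj
      rw [mem_range] at hj1
      rw [hw'lt _ hj1] at hj2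
      exact ⟨⟨j, hj1⟩, by simpa using hj2, rfl⟩
  have size : ∀ R : Finset (Fin n),
      #R ≤ D * (#{i : Fin (2 * k) | lift R (w i)} + 2 * #(cycleBoundary R)) := fun R => by
    refine (card_le_card_range_lift R hNge).trans
      ((card_filter_range_le (lift R) hmono hw'0 hD' (2 * k)).trans (Nat.mul_le_mul_left _ ?_))
    rw [nodes R]
    exact Nat.add_le_add_left (card_range_lift_change_le R hNle) _
  set A : Finset (Fin (2 * k)) := {i | lift S (w i)} with hA
  have hAc : ({i | lift Sᶜ (w i)} : Finset (Fin (2 * k))) = Aᶜ := by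
    ext i; simp [hA, lift_compl]
  have h1 := size S
  have h2 := size Sᶜ
  rw [hAc, cycleBoundary_compl] at h2
  have hbd : #(pathBoundary A) ≤ 2 * #(cycleBoundary S) := by
    refine le_trans ?_ ((card_change_le (lift S) hmono (2 * k)).trans
      (card_range_lift_change_le S hNle))
    refine card_le_card_of_injOn (fun i => (i : ℕ)) (fun i hi => ?_) fun i _ j _ => Fin.ext
    obtain ⟨j, hj, hij⟩ := mem_pathBoundary.1 hi
    refine mem_filter.2 ⟨mem_range.2 i.2, ?_⟩
    change ¬(lift S (w' i) ↔ lift S (w' (i + 1)))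
    rw [← hj, hw'lt _ i.2, hw'lt _ j.2]
    simpa [hA] using hij
  have hmin := h.min_card_le hs A
  have hcross : (A.filter fun i => s i ∉ A)
      = ({i | lift S (w i) ∧ ¬lift S (w (s i))} : Finset (Fin (2 * k))) := by
    ext i; simp [hA]
  rw [hcross] at hmin
  set c := #{i : Fin (2 * k) | lift S (w i) ∧ ¬lift S (w (s i))}
  have hSc : #S ≤ #Sᶜ := by
    have := card_add_card_compl S
    rw [Fintype.card_fin] at this
    omega
  have h3 : #S ≤ D * (min #A #Aᶜ + 2 * #(cycleBoundary S)) := by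
    rcases le_total #A #Aᶜ with hle | hle
    · rw [min_eq_left hle]; exact h1
    · rw [min_eq_right hle]; exact hSc.trans h2
  calc #S ≤ D * (min #A #Aᶜ + 2 * #(cycleBoundary S)) := h3
    -- The path boundary of `A` is at most twice the cycle boundary, whence `81 * 2 + 2 = 164`.
    _ ≤ D * (164 * (#(cycleBoundary S) + c)) := Nat.mul_le_mul_left _ (by omega)
    _ = _ := by ring

end Cycle

/-! ### The homogeneous chain: double stochasticity, outflow and confinement -/

section Chain

/-- The position of the `i`-th almost equidistant node, for spacing `L / 2`, before reduction modulo `n`. -/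
noncomputable def position (L : ℝ) (i : ℕ) : ℕ := ⌊(i : ℝ) * L / 2⌋₊

theorem m1Node_eq (α : ℝ) (n i : ℕ) : m1Node α n i = position ((n : ℝ) ^ (α - 1)) i % n := rfl

variable {α : ℝ} {n k : ℕ} {s : Equiv.Perm (Fin (2 * k))} {qc ql r d : ℝ}

theorem m1LongRange_symm (hs : s ∈ perfectMatchings (2 * k)) {x y : Fin n}
    (h : m1LongRange α n k s x y) : m1LongRange α n k s y x := by
  obtain ⟨i, hi, hi'⟩ := h
  exact ⟨s i, hi', by rw [(mem_perfectMatchings.1 hs i).2]; exact hi⟩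

theorem m1LongRange_unique (hinj : Function.Injective fun i : Fin (2 * k) => m1Node α n i)
    {x y z : Fin n} (h : m1LongRange α n k s x y) (h' : m1LongRange α n k s x z) : y = z := by
  obtain ⟨i, hi, hy⟩ := h
  obtain ⟨j, hj, hz⟩ := h'
  obtain rfl : i = j := hinj (hi.trans hj.symm)
  exact Fin.ext (hy.symm.trans hz)

open Classical in
theorem sum_m1LongRange_le (hinj : Function.Injective fun i : Fin (2 * k) => m1Node α n i)
    {a : ℝ} (ha : 0 ≤ a) (x : Fin n) : ∑ y, (if m1LongRange α n k s x y then a else 0) ≤ a := by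
  rw [← sum_filter, sum_const, nsmul_eq_mul]
  refine mul_le_of_le_one_left ha ?_
  exact_mod_cast card_le_one.2 fun y hy z hz =>
    m1LongRange_unique hinj (mem_filter.1 hy).2 (mem_filter.1 hz).2

section

variable [NeZero n]

open Classical in
theorem m1Step_eq (x y : Fin n) : m1Step α n k s qc ql r d x y =
    (if x + 1 = y then qc + r else 0) + (if y + 1 = x then qc - r else 0)
      + (if m1LongRange α n k s x y then ql / d else 0) := by
  simp only [m1Step, add_one_mod_eq_iff]

open Classical in
theorem sum_m1Step_right (x : Fin n) : ∑ y, m1Step α n k s qc ql r d x y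
    = 2 * qc + ∑ y, (if m1LongRange α n k s x y then ql / d else 0) := by
  have h : ∀ y : Fin n, y + 1 = x ↔ y = x - 1 := fun y => eq_sub_iff_add_eq.symm
  simp only [m1Step_eq, sum_add_distrib, h, sum_ite_eq, sum_ite_eq', mem_univ,
    if_true]
  ring

open Classical in
theorem sum_m1Step_left (hs : s ∈ perfectMatchings (2 * k)) (y : Fin n) :
    ∑ x, m1Step α n k s qc ql r d x y
    = 2 * qc + ∑ x, (if m1LongRange α n k s y x then ql / d else 0) := by
  have : ∀ x, m1LongRange α n k s x y ↔ m1LongRange α n k s y x :=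
    fun x => ⟨m1LongRange_symm hs, m1LongRange_symm hs⟩
  have h : ∀ x : Fin n, x + 1 = y ↔ x = y - 1 := fun x => eq_sub_iff_add_eq.symm
  simp only [m1Step_eq, this, sum_add_distrib, h, sum_ite_eq, sum_ite_eq',
    mem_univ, if_true]
  ring

theorem m1Step_nonneg (hr : |r| ≤ qc) (hql : 0 < ql) (hd : 1 ≤ d) (x y : Fin n) :
    0 ≤ m1Step α n k s qc ql r d x y := by
  obtain ⟨h1, h2⟩ := abs_le.1 hr
  rw [m1Step_eq]
  refine add_nonneg (add_nonneg ?_ ?_) ?_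
  · split_ifs <;> linarith
  · split_ifs <;> linarith
  · have : 0 ≤ ql / d := div_nonneg hql.le (by linarith)
    split_ifs
    · exact this
    · exact le_rfl

omit [NeZero n] in
theorem m1Chain_row (x : Fin n) : ∑ y, m1Chain α n k s qc ql r d x y = 1 := by
  simp [m1Chain, sum_add_distrib]

theorem m1Chain_col (hs : s ∈ perfectMatchings (2 * k)) (y : Fin n) :
    ∑ x, m1Chain α n k s qc ql r d x y = 1 := by
  simp only [m1Chain, sum_add_distrib, sum_ite_eq', mem_univ, if_true, sum_m1Step_left hs,
    sum_m1Step_right]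
  ring

theorem half_le_m1Chain (hinj : Function.Injective fun i : Fin (2 * k) => m1Node α n i)
    (hr : |r| ≤ qc) (hql : 0 < ql) (hd : 1 ≤ d) (hlazy : 2 * qc + ql / d ≤ 1 / 2) (x : Fin n) :
    1 / 2 ≤ m1Chain α n k s qc ql r d x x := by
  have h1 := m1Step_nonneg (α := α) (s := s) hr hql hd x x
  have h2 := sum_m1LongRange_le (s := s) hinj (div_nonneg hql.le (by linarith) : 0 ≤ ql / d) x
  simp only [m1Chain, if_true, sum_m1Step_right]
  linarith

theorem m1Chain_nonneg (hinj : Function.Injective fun i : Fin (2 * k) => m1Node α n i)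
    (hr : |r| ≤ qc) (hql : 0 < ql) (hd : 1 ≤ d) (hlazy : 2 * qc + ql / d ≤ 1 / 2) (x y : Fin n) :
    0 ≤ m1Chain α n k s qc ql r d x y := by
  by_cases h : x = y
  · subst h
    exact le_trans (by norm_num) (half_le_m1Chain hinj hr hql hd hlazy x)
  · simpa [m1Chain, h] using m1Step_nonneg hr hql hd x y

/-- A set on the cycle is left clockwise as often as it is entered, so the rates `qc + r` and `qc -
r` act on equally many edges and the drift cancels. Distinct crossing indices give distinct long
range moves because the nodes are distinct. -/
theorem le_cut_m1Chain (hinj : Function.Injective fun i : Fin (2 * k) => m1Node α n i)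
    (hql : 0 < ql) (hd : 1 ≤ d) (S : Finset (Fin n)) :
    qc * #(cycleBoundary S) + ql / d * #{i : Fin (2 * k) |
        lift S (position ((n : ℝ) ^ (α - 1)) i) ∧ ¬lift S (position ((n : ℝ) ^ (α - 1)) (s i))}
      ≤ ∑ x ∈ S, ∑ y ∈ Sᶜ, m1Chain α n k s qc ql r d x y := by
  classical
  have e0 : ∑ x ∈ S, ∑ y ∈ Sᶜ, m1Chain α n k s qc ql r d x y
      = ∑ x ∈ S, ∑ y ∈ Sᶜ, m1Step α n k s qc ql r d x y := by
    refine sum_congr rfl fun x hx => sum_congr rfl fun y hy => ?_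
    have : x ≠ y := fun h => (mem_compl.1 hy) (h ▸ hx)
    simp [m1Chain, this]
  have e1 : ∑ x ∈ S, ∑ y ∈ Sᶜ, (if x + 1 = y then qc + r else 0)
      = (qc + r) * #{x ∈ S | x + 1 ∉ S} := by
    simp only [sum_ite_eq, mem_compl, ← sum_filter, sum_const, nsmul_eq_mul, mul_comm]
  have e2 : ∑ x ∈ S, ∑ y ∈ Sᶜ, (if y + 1 = x then qc - r else 0)
      = (qc - r) * #{x ∈ S | x + 1 ∉ S} := by
    rw [sum_comm, card_leaving_eq]
    simp only [sum_ite_eq, ← sum_filter, sum_const, nsmul_eq_mul, mul_comm]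
  have e3 : (#{i : Fin (2 * k) |
        lift S (position ((n : ℝ) ^ (α - 1)) i) ∧ ¬lift S (position ((n : ℝ) ^ (α - 1)) (s i))} : ℝ)
      * (ql / d) ≤ ∑ x ∈ S, ∑ y ∈ Sᶜ, (if m1LongRange α n k s x y then ql / d else 0) := by
    rw [← sum_product', ← sum_filter, sum_const, nsmul_eq_mul]
    refine mul_le_mul_of_nonneg_right ?_ (div_nonneg hql.le (by linarith))
    norm_cast
    refine card_le_card_of_injOn (fun i => (Fin.ofNat n (position ((n : ℝ) ^ (α - 1)) i),
      Fin.ofNat n (position ((n : ℝ) ^ (α - 1)) (s i)))) (fun i hi => ?_) fun i _ j _ hij => ?_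
    · obtain ⟨h1, h2⟩ := (mem_filter.1 hi).2
      exact mem_filter.2 ⟨mem_product.2 ⟨h1, mem_compl.2 h2⟩, i, rfl, rfl⟩
    · exact hinj (congrArg Fin.val (Prod.mk.inj hij).1)
  have e4 : (#(cycleBoundary S) : ℝ) = 2 * #{x ∈ S | x + 1 ∉ S} := by
    exact_mod_cast card_cycleBoundary S
  simp only [e0, m1Step_eq, sum_add_distrib, e1, e2, e4]
  linarith

end

section Position

variable {L : ℝ} (hL : 1 ≤ L)
include hL

theorem position_mono : Monotone (position L) := fun i j hij => by
  have : (i : ℝ) ≤ j := by exact_mod_cast hij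
  exact Nat.floor_le_floor (by gcongr)

theorem position_le (i : ℕ) : (position L i : ℝ) ≤ i * L / 2 := Nat.floor_le (by positivity)

omit hL in
theorem lt_position_add_one (i : ℕ) : (i : ℝ) * L / 2 < position L i + 1 := Nat.lt_floor_add_one _

theorem position_succ_le (i : ℕ) : position L (i + 1) ≤ position L i + (⌈3 * L / 2⌉₊ + 1) := by
  have h1 := position_le hL (i + 1)
  have h2 := lt_position_add_one (L := L) i
  have h3 := Nat.le_ceil (3 * L / 2)
  push_cast at h1
  have : (position L (i + 1) : ℝ) ≤ position L i + (⌈3 * L / 2⌉₊ + 1) := by linarith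
  exact_mod_cast this

omit hL in
-- This last gap, of length up to `3L / 2 + 1`, dictates the block length; the other gaps are about
-- `L / 2`.
theorem le_position_last {n k : ℕ} (hk : 0 < k) (hkn : (n : ℝ) ≤ (k + 1) * L) :
    n ≤ position L (2 * k - 1) + (⌈3 * L / 2⌉₊ + 1) := by
  have h2 := lt_position_add_one (L := L) (2 * k - 1)
  have h3 := Nat.le_ceil (3 * L / 2)
  rw [Nat.cast_sub (by omega)] at h2
  push_cast at h2
  have : (n : ℝ) ≤ position L (2 * k - 1) + (⌈3 * L / 2⌉₊ + 1) := by linarith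
  exact_mod_cast this

theorem position_last_le {n k : ℕ} (hk : 0 < k) (hkn : (k : ℝ) * L ≤ n + L) :
    (position L (2 * k - 1) : ℝ) ≤ n + L / 2 := by
  have h2 := position_le hL (2 * k - 1)
  rw [Nat.cast_sub (by omega)] at h2
  push_cast at h2
  linarith

end Position

theorem cut_m1Chain [NeZero n] {L : ℝ} (hLdef : (n : ℝ) ^ (α - 1) = L) (hL : 1 ≤ L) (hLn : L ≤ n)
    (hk : 0 < k) (hk1 : (k : ℝ) * L ≤ n + L) (hk2 : (n : ℝ) ≤ (k + 1) * L)
    (hinj : Function.Injective fun i : Fin (2 * k) => m1Node α n i)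
    (hs : s ∈ perfectMatchings (2 * k)) (hexp : IsExpanding k s)
    (hqc : 0 < qc) (hql : 0 < ql) (hd : 1 ≤ d) (S : Finset (Fin n)) (hS : 2 * #S ≤ Fintype.card (Fin n)) :
    min qc ql / (656 * d * L) * #S ≤ ∑ x ∈ S, ∑ y ∈ Sᶜ, m1Chain α n k s qc ql r d x y := by
  rw [Fintype.card_fin] at hS
  have h1 := card_le_of_isExpanding hk hexp hs (position_mono hL) (by simp [position])
    (position_succ_le hL) (le_position_last hk hk2) (by
      have := position_last_le hL hk hk1
      have h : (position L (2 * k - 1) : ℝ) ≤ 2 * n := by linarith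
      exact_mod_cast h) S hS
  have h2 := le_cut_m1Chain (r := r) (qc := qc) (s := s) hinj hql hd S
  rw [hLdef] at h2
  refine le_trans ?_ h2
  set b := #(cycleBoundary S)
  set c := #{i : Fin (2 * k) | lift S (position L i) ∧ ¬lift S (position L (s i))}
  -- This bound on the block length yields the constant `656 = 164 * 4`.
  have hD : ((⌈3 * L / 2⌉₊ + 1 : ℕ) : ℝ) ≤ 4 * L := by
    have := Nat.ceil_lt_add_one (by positivity : 0 ≤ 3 * L / 2)
    push_cast
    linarith
  have h3 : (#S : ℝ) ≤ 164 * (4 * L) * (b + c) := by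
    calc (#S : ℝ) ≤ 164 * ((⌈3 * L / 2⌉₊ + 1 : ℕ) : ℝ) * (b + c) := by exact_mod_cast h1
      _ ≤ _ := by gcongr
  have hκ : 0 < min qc ql := lt_min hqc hql
  have hd0 : 0 < d := by linarith
  calc min qc ql / (656 * d * L) * #S ≤ min qc ql / (656 * d * L) * (164 * (4 * L) * (b + c)) := by
        gcongr
    _ = min qc ql / d * b + min qc ql / d * c := by field_simp; ring
    _ ≤ qc * b + ql / d * c := by
      gcongr
      · exact (div_le_self hκ.le hd).trans (min_le_left _ _)
      · exact min_le_right _ _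

theorem support_m1Chain {x y : Fin n} (h : m1Chain α n k s qc ql r d x y ≠ 0)
    (hx : ∀ i : Fin (2 * k), m1Node α n i ≠ x) :
    x = y ∨ ((x : ℕ) + 1) % n = y ∨ ((y : ℕ) + 1) % n = x := by
  by_contra hc
  push Not at hc
  obtain ⟨h1, h2, h3⟩ := hc
  have h4 : ¬m1LongRange α n k s x y := fun ⟨i, hi, _⟩ => hx i hi
  simp [m1Chain, m1Step, h1, h2, h3, h4] at h

/-- Nodes that wrap around cannot fall into the gap: unwrapped positions overshoot `n` by at most `L
/ 2`, so they reduce to at most `position L 1`. -/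
theorem m1Node_notMem_Ioo {L : ℝ} (hLdef : (n : ℝ) ^ (α - 1) = L) (hL : 1 ≤ L)
    (hk : 0 < k) (hk1 : (k : ℝ) * L ≤ n + L) (i : Fin (2 * k)) :
    ¬((position L 1 < m1Node α n i) ∧ m1Node α n i < position L 2) := by
  rintro ⟨h1, h2⟩
  rw [m1Node_eq, hLdef] at h1 h2
  have hmono := position_mono hL
  rcases lt_or_ge (position L i) n with h | h
  · rw [Nat.mod_eq_of_lt h] at h1 h2
    have a1 : 1 < (i : ℕ) := hmono.reflect_lt h1
    have a2 : (i : ℕ) < 2 := hmono.reflect_lt h2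
    omega
  · have h3 : (position L i : ℝ) ≤ n + L / 2 := by
      refine le_trans ?_ (position_last_le hL hk hk1)
      exact_mod_cast hmono (by omega : (i : ℕ) ≤ 2 * k - 1)
    have h4 : position L i - n ≤ position L 1 := by
      refine Nat.le_floor ?_
      rw [Nat.cast_sub h]
      push_cast
      linarith
    have h5 : position L i % n ≤ position L i - n := by
      rw [Nat.mod_eq_sub_mod h]
      exact Nat.mod_le _ _
    omega

/-- With no node within distance `t₀` of `x₀`, only cycle moves are available, and the window is too
short to reach the point where the cycle closes up. -/
theorem support_vecMul_m1Chain_pow {x₀ t₀ : ℕ} (hx₀ : x₀ + t₀ + 1 < n) (ht₀ : t₀ < x₀)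
    (hnode : ∀ i : Fin (2 * k), ∀ t ≤ t₀, m1Node α n i ≠ x₀ + t ∧ m1Node α n i + t ≠ x₀)
    (t : ℕ) (ht : t ≤ t₀) (y : Fin n)
    (hy : Matrix.vecMul (Pi.single ⟨x₀, by omega⟩ 1) (m1Chain α n k s qc ql r d ^ t) y ≠ 0) :
    x₀ ≤ y + t ∧ (y : ℕ) ≤ x₀ + t := by
  induction t generalizing y with
  | zero =>
    have : y = ⟨x₀, by omega⟩ := by
      by_contra hne
      simp [hne] at hy
    simp [this]
  | succ t ih =>
    rw [pow_succ, ← Matrix.vecMul_vecMul] at hy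
    obtain ⟨x, -, hx⟩ := exists_ne_zero_of_sum_ne_zero (show ∑ x, Matrix.vecMul
      (Pi.single ⟨x₀, by omega⟩ 1) (m1Chain α n k s qc ql r d ^ t) x * m1Chain α n k s qc ql r d x y ≠ 0
      from hy)
    obtain ⟨h1, h2⟩ := ih (by omega) x (left_ne_zero_of_mul hx)
    have hn : ∀ i : Fin (2 * k), m1Node α n i ≠ x := fun i hi => by
      rcases le_total x₀ (x : ℕ) with hle | hle
      · exact (hnode i (x - x₀) (by omega)).1 (by omega)
      · exact (hnode i (x₀ - x) (by omega)).2 (by omega)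
    have hyn := y.2
    rcases support_m1Chain (right_ne_zero_of_mul hx) hn with h | h | h
    · rw [← h]; omega
    · rw [Nat.mod_eq_of_lt (by omega)] at h; omega
    · rcases eq_or_lt_of_le (Nat.succ_le_of_lt hyn) with h' | h'
      · rw [show (y : ℕ) + 1 = n from h', Nat.mod_self] at h; omega
      · rw [Nat.mod_eq_of_lt h'] at h; omega

theorem tvDist_m1Chain_pow_ge {x₀ t₀ : ℕ} (hx₀ : x₀ + t₀ + 1 < n) (ht₀ : t₀ < x₀)
    (hnode : ∀ i : Fin (2 * k), ∀ t ≤ t₀, m1Node α n i ≠ x₀ + t ∧ m1Node α n i + t ≠ x₀)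
    (t : ℕ) (ht : t ≤ t₀) :
    1 - (2 * t + 1) / (n : ℝ)
      ≤ tvDist (Matrix.vecMul (Pi.single ⟨x₀, by omega⟩ 1) (m1Chain α n k s qc ql r d ^ t))
        (fun _ => 1 / (n : ℝ)) := by
  set μ := Matrix.vecMul (Pi.single (⟨x₀, by omega⟩ : Fin n) 1) (m1Chain α n k s qc ql r d ^ t) with hμ
  set A : Finset (Fin n) := {y | x₀ ≤ y + t ∧ (y : ℕ) ≤ x₀ + t} with hA
  have hsum : ∀ t : ℕ, ∑ y, Matrix.vecMul (Pi.single (⟨x₀, by omega⟩ : Fin n) 1)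
      (m1Chain α n k s qc ql r d ^ t) y = 1 := fun t => by
    induction t with
    | zero => simp
    | succ t ih =>
      rw [pow_succ, ← Matrix.vecMul_vecMul, sum_vecMul_eq _ m1Chain_row, ih]
  have h1 : ∑ y ∈ A, μ y = 1 := by
    rw [← hsum t]
    refine sum_subset (subset_univ _) fun y _ hy => ?_
    by_contra hne
    exact hy (mem_filter.2 ⟨mem_univ _, support_vecMul_m1Chain_pow hx₀ ht₀ hnode t ht y hne⟩)
  have h2 : #A ≤ 2 * t + 1 := by
    calc #A ≤ #(Icc (x₀ - t) (x₀ + t)) := by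
          refine card_le_card_of_injOn (fun y => (y : ℕ)) (fun y hy => ?_) fun _ _ _ _ => Fin.ext
          obtain ⟨g1, g2⟩ := (mem_filter.1 hy).2
          exact mem_Icc.2 ⟨Nat.sub_le_iff_le_add.2 g1, g2⟩
      _ ≤ 2 * t + 1 := by rw [Nat.card_Icc]; omega
  have h3 : (#A : ℝ) ≤ 2 * t + 1 := by exact_mod_cast h2
  refine le_trans ?_ ((le_abs_self _).trans (le_tvDist μ (fun _ => 1 / (n : ℝ)) A))
  rw [h1, sum_const, nsmul_eq_mul, mul_one_div]
  gcongr

end Chain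

/-! ### Assembly of the two bounds -/

section Main

theorem uniform_mixing_time_le {n : ℕ} {ε Φ : ℝ} (hε : 0 < ε) (hΦ : 0 < Φ) (hn : 1 / ε ≤ n) {t : ℕ}
    (ht : 24 * Real.log n / Φ ^ 2 ≤ t) : √(n * Real.exp (-(Φ ^ 2 / 8) * t)) ≤ ε := by
  have hn0 : (0 : ℝ) < n := (by positivity : 0 < 1 / ε).trans_le hn
  rw [Real.sqrt_le_left hε.le]
  rw [div_le_iff₀ (by positivity)] at ht
  -- Here `24 / 8 = 3`: one power of `n` offsets the factor `n` in front, and the other two give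
  -- `n⁻² ≤ ε²`.
  have h1 : Real.exp (-(Φ ^ 2 / 8) * t) ≤ ((n : ℝ) ^ 3)⁻¹ := by
    rw [← Real.exp_log (by positivity : (0 : ℝ) < ((n : ℝ) ^ 3)⁻¹), Real.log_inv, Real.log_pow]
    refine Real.exp_le_exp.2 ?_
    push_cast
    linarith
  have h2 : (n : ℝ)⁻¹ ≤ ε := by
    rw [inv_le_comm₀ hn0 hε, ← one_div]; exact hn
  calc (n : ℝ) * Real.exp (-(Φ ^ 2 / 8) * t) ≤ n * ((n : ℝ) ^ 3)⁻¹ := by gcongr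
    _ = ((n : ℝ)⁻¹) ^ 2 := by field_simp
    _ ≤ ε ^ 2 := by gcongr

theorem exists_mixingTime_m1Chain {ε qc ql r d α L : ℝ} {n k : ℕ} {s : Equiv.Perm (Fin (2 * k))}
    (hε0 : 0 < ε) (hqc : 0 < qc) (hql : 0 < ql) (hr : |r| ≤ qc) (hd : 1 ≤ d)
    (hlazy : 2 * qc + ql / d ≤ 1 / 2) (hLdef : (n : ℝ) ^ (α - 1) = L) (hL : 16 ≤ L)
    (hLε : L < (1 - ε) * n) (hlog : 1 < Real.log n) (hn : 1 / ε ≤ n) (hk : 0 < k)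
    (hk1 : (k : ℝ) * L ≤ n + L) (hk2 : (n : ℝ) ≤ (k + 1) * L)
    (hinj : Function.Injective fun i : Fin (2 * k) => m1Node α n i)
    (hs : s ∈ perfectMatchings (2 * k)) (hexp : IsExpanding k s) :
    ∃ T : ℕ, HasMixingTime (m1Chain α n k s qc ql r d) ε T ∧ 1 / 16 * L < (T : ℝ) ∧
      (T : ℝ) < 25 * 656 ^ 2 / min qc ql ^ 2 * d ^ 2 * L ^ 2 * Real.log n := by
  have hn0 : (0 : ℝ) < n := (by positivity : 0 < 1 / ε).trans_le hn
  have : NeZero n := ⟨by rintro rfl; simp at hn0⟩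
  have hL1 : 1 ≤ L := by linarith
  have hL0 : 0 < L := by linarith
  have hd0 : 0 < d := by linarith
  have hLn : L ≤ n := by nlinarith
  have hκ : 0 < min qc ql := lt_min hqc hql
  set Φ := min qc ql / (656 * d * L) with hΦ
  have hΦ0 : 0 < Φ := by positivity
  have hΦ1 : Φ ≤ 1 := by
    rw [hΦ, div_le_one (by positivity)]
    have : 0 < ql / d := by positivity
    have h2 : 1 ≤ d * L := by nlinarith
    linarith [min_le_left qc ql]
  have hP := m1Chain_nonneg (s := s) hinj hr hql hd hlazy
  have hcol := m1Chain_col (α := α) (n := n) (qc := qc) (ql := ql) (r := r) (d := d) hs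
  have hdiag := half_le_m1Chain (s := s) hinj hr hql hd hlazy
  have hcut := cut_m1Chain (r := r) hLdef hL1 hLn hk hk1 hk2 hinj hs hexp hqc hql hd
  have hstat := isUniqueStationary_uniform (m1Chain α n k s qc ql r d) Φ hΦ0 hP m1Chain_row hcol
    hdiag hcut
  set t₁ : ℕ := ⌈24 * Real.log n / Φ ^ 2⌉₊ with ht₁
  set t₀ : ℕ := ⌊L / 16⌋₊ with ht₀
  -- The middle of the gap from `L / 2` to `L`. Its distance `L / 4` to either end exceeds `L / 16`
  -- with enough room for all roundings, as `L ≥ 16`.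
  set x₀ : ℕ := ⌊3 * L / 4⌋₊ with hx₀
  have a1 : (t₀ : ℝ) ≤ L / 16 := Nat.floor_le (by positivity)
  have a2 : (x₀ : ℝ) ≤ 3 * L / 4 := Nat.floor_le (by positivity)
  have a3 : 3 * L / 4 < x₀ + 1 := Nat.lt_floor_add_one _
  have b1 : x₀ + t₀ + 1 < n := by
    have : ((x₀ + t₀ + 1 : ℕ) : ℝ) < n := by push_cast; linarith
    exact_mod_cast this
  have hp1 : (position L 1 : ℝ) ≤ L / 2 := by simpa using position_le hL1 1
  have hp2 : L < position L 2 + 1 := by simpa using lt_position_add_one (L := L) 2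
  have b2 : position L 1 + t₀ < x₀ := by
    have : ((position L 1 + t₀ : ℕ) : ℝ) < x₀ := by push_cast; linarith
    exact_mod_cast this
  have b3 : x₀ + t₀ < position L 2 := by
    have : ((x₀ + t₀ : ℕ) : ℝ) < position L 2 := by push_cast; linarith
    exact_mod_cast this
  have hnode : ∀ i : Fin (2 * k), ∀ t ≤ t₀, m1Node α n i ≠ x₀ + t ∧ m1Node α n i + t ≠ x₀ :=
    fun i t ht => by
      have := m1Node_notMem_Ioo hLdef hL1 hk hk1 i
      omega
  obtain ⟨T, hT, hT0, hT1⟩ := exists_hasMixingTime (m1Chain α n k s qc ql r d) _ hstat ε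
    (Pi.single ⟨x₀, by omega⟩ 1) (single_mem_stdSimplex ℝ _) t₀ t₁
    (fun τ hτ => (tvDist_vecMul_pow_le _ Φ hΦ0.le hP m1Chain_row hcol hdiag hcut τ hτ t₁).trans (by
      rw [Fintype.card_fin]
      exact uniform_mixing_time_le hε0 hΦ0 hn (Nat.le_ceil _)))
    (fun t ht => by
      rw [Fintype.card_fin]
      refine lt_of_lt_of_le ?_ (tvDist_m1Chain_pow_ge b1 (by omega) hnode t ht)
      have h1 : (t : ℝ) ≤ t₀ := by exact_mod_cast ht
      have h2 : (2 * t + 1) / (n : ℝ) < 1 - ε := by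
        rw [div_lt_iff₀ hn0]; linarith
      linarith)
  refine ⟨T, hT, ?_, ?_⟩
  · have h1 := Nat.lt_floor_add_one (L / 16)
    have h2 : ((t₀ + 1 : ℕ) : ℝ) ≤ T := by exact_mod_cast hT0
    push_cast at h2
    linarith
  · have h1 : (T : ℝ) ≤ t₁ := by exact_mod_cast hT1
    have h2 : (t₁ : ℝ) < 24 * Real.log n / Φ ^ 2 + 1 := Nat.ceil_lt_add_one (by positivity)
    -- The rounding up in `t₁` costs at most one more `log n / Φ²`, which turns 24 into 25.
    have h3 : 1 ≤ Real.log n / Φ ^ 2 := by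
      rw [le_div_iff₀ (by positivity)]
      have : Φ ^ 2 ≤ 1 := pow_le_one₀ hΦ0.le hΦ1
      linarith
    have h4 : 25 * 656 ^ 2 / min qc ql ^ 2 * d ^ 2 * L ^ 2 * Real.log n
        = 24 * Real.log n / Φ ^ 2 + Real.log n / Φ ^ 2 := by
      rw [hΦ]; field_simp; ring
    rw [h4]
    linarith

open Classical in
theorem matchingProb_le_one (m : ℕ) (E : Equiv.Perm (Fin m) → Prop) : matchingProb m E ≤ 1  := by
  unfold matchingProb
  exact div_le_one_of_le₀ (Nat.cast_le.2 (card_le_card (filter_subset _ _))) (Nat.cast_nonneg _)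

theorem matchingProb_ge {k : ℕ} (hk : 0 < k) {E : Equiv.Perm (Fin (2 * k)) → Prop}
    (hE : ∀ s ∈ perfectMatchings (2 * k), IsExpanding k s → E s) :
    1 - 800 / (k : ℝ) ≤ matchingProb (2 * k) E := by
  classical
  have hpos : (0 : ℝ) < #(perfectMatchings (2 * k)) := by
    exact_mod_cast (perfectMatchings_nonempty k).card_pos
  have h1 := card_not_isExpanding_le k hk
  have h2 : #(perfectMatchings (2 * k))
      ≤ #{s ∈ perfectMatchings (2 * k) | E s} + #{s ∈ perfectMatchings (2 * k) | ¬IsExpanding k s} := by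
    rw [← card_filter_add_card_filter_not (s := perfectMatchings (2 * k)) (fun s => E s)]
    refine Nat.add_le_add_left (card_le_card fun s hs => ?_) _
    obtain ⟨hs1, hs2⟩ := mem_filter.1 hs
    exact mem_filter.2 ⟨hs1, fun h => hs2 (hE s hs1 h)⟩
  have h3 : (#(perfectMatchings (2 * k)) : ℝ) ≤ #{s ∈ perfectMatchings (2 * k) | E s}
      + #{s ∈ perfectMatchings (2 * k) | ¬IsExpanding k s} := by exact_mod_cast h2
  have h4 : matchingProb (2 * k) E
      = (#{s ∈ perfectMatchings (2 * k) | E s} : ℝ) / #(perfectMatchings (2 * k)) := by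
    unfold matchingProb
    congr
  rw [h4, le_div_iff₀ hpos]
  linarith

end Main
end SmallWorld

theorem mainTheorem3
    (ε : ℝ) (hε0 : 0 < ε) (hε1 : ε < 1)
    (qc ql r : ℝ) (hqc : 0 < qc) (hql : 0 < ql) (hr : |r| ≤ qc) :
    ∃ c₁ : ℝ, 0 < c₁ ∧ ∃ c₂ : ℝ, 0 < c₂ ∧
      ∀ α : ℝ, 1 < α → α < 2 →
      ∀ d : ℝ, 1 ≤ d → 2 * qc + ql / d ≤ 1 / 2 →
      ∀ k : ℕ → ℕ,
        (∀ n : ℕ, k n = ⌈(n : ℝ) ^ (2 - α)⌉₊ ∨ k n = ⌊(n : ℝ) ^ (2 - α)⌋₊) →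
        (∀ᶠ n : ℕ in Filter.atTop,
          Function.Injective fun i : Fin (2 * k n) => m1Node α n i) →
        Filter.Tendsto
          (fun n : ℕ => matchingProb (2 * k n) fun s =>
            ∃ T : ℕ, HasMixingTime (m1Chain α n (k n) s qc ql r d) ε T ∧
              c₁ * (n : ℝ) ^ (α - 1) < (T : ℝ) ∧
              (T : ℝ) < c₂ * d ^ 2 * (n : ℝ) ^ (2 * α - 2) * Real.log (n : ℝ))
          Filter.atTop (nhds 1) := by
  have hκ : 0 < min qc ql := lt_min hqc hql
  refine ⟨1 / 16, by norm_num, 25 * 656 ^ 2 / min qc ql ^ 2, by positivity, ?_⟩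
  intro α hα1 hα2 d hd hlazy k hk hinj
  have hcast := tendsto_natCast_atTop_atTop (R := ℝ)
  have hL := (tendsto_rpow_atTop (by linarith : 0 < α - 1)).comp hcast
  have hK := (tendsto_rpow_atTop (by linarith : 0 < 2 - α)).comp hcast
  have hlog := Real.tendsto_log_atTop.comp hcast
  have hkb : ∀ n : ℕ, (k n : ℝ) ≤ (n : ℝ) ^ (2 - α) + 1 ∧ (n : ℝ) ^ (2 - α) ≤ k n + 1 := fun n => by
    have h0 : (0 : ℝ) ≤ (n : ℝ) ^ (2 - α) := by positivity
    rcases hk n with h | h <;> rw [h]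
    · exact ⟨(Nat.ceil_lt_add_one h0).le, (Nat.le_ceil _).trans (by linarith)⟩
    · exact ⟨(Nat.floor_le h0).trans (by linarith), (Nat.lt_floor_add_one _).le⟩
  have hkt : Filter.Tendsto (fun n => (k n : ℝ)) Filter.atTop Filter.atTop := by
    refine Filter.tendsto_atTop_mono (fun n => ?_) (Filter.tendsto_atTop_add_const_right _ (-1) hK)
    have := (hkb n).2
    simp only [Function.comp]
    linarith
  have hlim : Filter.Tendsto (fun n => 1 - 800 / (k n : ℝ)) Filter.atTop (nhds 1) := by
    simpa using (hkt.const_div_atTop 800).const_sub 1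
  refine tendsto_of_tendsto_of_tendsto_of_le_of_le' hlim tendsto_const_nhds ?_
    (Filter.Eventually.of_forall fun n => SmallWorld.matchingProb_le_one _ _)
  filter_upwards [hinj, hL.eventually_ge_atTop 16, hK.eventually_gt_atTop (1 / (1 - ε)),
    hlog.eventually_gt_atTop 1, hcast.eventually_ge_atTop (1 / ε), hkt.eventually_gt_atTop 0,
    Filter.eventually_gt_atTop 0] with n hinj hL16 hKε hlog1 hnε hk0 hn0
  simp only [Function.comp] at hL16 hKε hlog1
  have hn : (0 : ℝ) < n := by exact_mod_cast hn0
  have hk0' : 0 < k n := by exact_mod_cast hk0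
  refine SmallWorld.matchingProb_ge hk0' fun s hs hexp => ?_
  -- Since `k n` differs from `n^(2-α)` by at most 1, this identity gives `k L ≤ n + L` and `n ≤ (k
  -- + 1) L`. It also turns `n^(2-α) > 1 / (1 - ε)` into `L < (1 - ε) n`.
  have hprod : (n : ℝ) ^ (2 - α) * (n : ℝ) ^ (α - 1) = n := by
    rw [← Real.rpow_add hn]; norm_num
  have hsq : (n : ℝ) ^ (2 * α - 2) = ((n : ℝ) ^ (α - 1)) ^ 2 := by
    rw [← Real.rpow_natCast, ← Real.rpow_mul hn.le]; congr 1; push_cast; ring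
  rw [hsq]
  have hLpos : (0 : ℝ) < (n : ℝ) ^ (α - 1) := by positivity
  refine SmallWorld.exists_mixingTime_m1Chain hε0 hqc hql hr hd hlazy rfl hL16 ?_ hlog1 hnε hk0'
    ?_ ?_ hinj hs hexp
  · rw [div_lt_iff₀ (by linarith)] at hKε
    nlinarith
  · nlinarith [(hkb n).1]
  · nlinarith [(hkb n).2]
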